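/- Let $d\ge 3$ and $a>0$. The Ellis–Bronnikov wormhole is $\mathbb R_t\times\mathbb R_r\times S^{d-1}$ with metric $ds^2=dt^2-dr^2-(r^2+a^2)\,d\Omega_{d-1}^2$. Put $\tan\frac{T\pm\chi}{2}=t\pm r$. The spacetime becomes $\{|T|+|\chi|<\pi\}\times S^{d-1}$, and the metric is conformal to $$\widetilde{ds}^2=dT^2-d\chi^2-\big(\sin^2\chi+a^2(\cos T+\cos\chi)^2\big)\,d\Omega_{d-1}^2=dT^2-d\chi^2-\Big(1+\frac{a^2}{r^2}\Big)\sin^2\chi\, d\Omega_{d-1}^2 .$$ Let $\tilde M$ be this region together with its null boundary $\mathcal I^\pm_1=\{\pm T+\chi=\pi,\ \pm T>0,\ \chi>0\}\times S^{d-1}$ (the universe $r>0$) and $\mathcal I^\pm_2=\{\pm T-\chi=\pi,\ \pm T>0,\ \chi<0\}\times S^{d-1}$ (the universe $r<0$). For $x\in\tilde M$ let $I^+(x)$ be the set of $y\in\tilde M$ such that there is a smooth future-directed timelike curve in $(\tilde M,\widetilde{ds}^2)$ from $x$ to $y$, and let $J^-(x)$ consist of $x$ and of all $y\in\tilde M$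 such that there is a smooth future-directed causal curve in $\tilde M$ from $y$ to $x$. The impact parameter $R$ of a curve is the smallest value of $r$ that it attains. An equatorial plane is the set of points whose $S^{d-1}$-component lies in a given two-dimensional linear subspace of $\mathbb R^d$. **Proposition.** Let $p\in\mathcal I^-_1$. There is a point $q\in\mathcal I^+_1$ with the following properties. 1. Let an equatorial plane through $p$ be given, and consider the inextendible future-directed null geodesics of $ds^2$ in this plane with past endpoint $p$. For every $R>0$ there is such a geodesic with impact parameter $R$; its image is unique up to the reflection of the plane that fixes the angle of $p$; and every such geodesic has a future endpoint on $\mathcal I^+_1$. As $R\to\infty$ these future endpoints tend to $q$. 2. A point of $\mathcal I^+_1$ cannot be reached from $p$ by a smooth future-directed timelike curve in $\tilde M$ if and only if it is $q$ or can be reached from $q$ by a past-pointing null geodesic of $(\tilde M,\widetilde{ds}^2)$. 3. $I^+(p)\cap\mathcal I^+_1=\mathcal I^+_1\setminus\big(J^-(q)\cap\mathcal I^+_1\big)$. -/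

import Mathlib

open scoped ContDiff

namespace Wormhole

/-- Coordinate triples. They are read as `(t, r, ω)` in the physical spacetime and as `(T, χ, ω)` in
its conformal compactification. The unit sphere `S^{d-1}` is the set of `ω` with `‖ω‖ = 1` in `ℝ^d`;
the inner product of `ℝ^d` induces its round metric, and a curve in `S^{d-1}` is smooth iff it is
smooth as a curve in `ℝ^d`. -/
abbrev Coord (d : ℕ) : Type := ℝ × ℝ × EuclideanSpace ℝ (Fin d)

/-- The Ellis–Bronnikov metric `dt² - dr² - (r² + a²) dΩ²` at `x = (t, r, ω)`, as a bilinear form. -/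
noncomputable def physMetric {d : ℕ} (a : ℝ) (x v w : Coord d) : ℝ :=
  v.1 * w.1 - v.2.1 * w.2.1 - (x.2.1 ^ 2 + a ^ 2) * inner ℝ v.2.2 w.2.2

/-- The conformally related metric `dT² - dχ² - (1 + a²/r²) sin² χ dΩ²` at `x = (T, χ, ω)`, where
`r = sin χ / (cos T + cos χ)`; written without denominators, so that it also makes sense at the
throat `χ = 0`. -/
noncomputable def confMetric {d : ℕ} (a : ℝ) (x v w : Coord d) : ℝ :=
  v.1 * w.1 - v.2.1 * w.2.1
    - (Real.sin x.2.1 ^ 2 + a ^ 2 * (Real.cos x.1 + Real.cos x.2.1) ^ 2) * inner ℝ v.2.2 w.2.2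

/-- The compactification map `(t, r, ω) ↦ (T, χ, ω)` with `tan ((T ± χ) / 2) = t ± r`. -/
noncomputable def compactify {d : ℕ} (x : Coord d) : Coord d :=
  (Real.arctan (x.1 + x.2.1) + Real.arctan (x.1 - x.2.1),
    Real.arctan (x.1 + x.2.1) - Real.arctan (x.1 - x.2.1), x.2.2)

/-- The image of the physical spacetime in the compactification. -/
def bulk (d : ℕ) : Set (Coord d) := {x | |x.1| + |x.2.1| < Real.pi ∧ ‖x.2.2‖ = 1}

/-- Future null infinity of the universe `r > 0`. -/
def scriPlus₁ (d : ℕ) : Set (Coord d) :=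
  {x | 0 < x.1 ∧ 0 < x.2.1 ∧ x.1 + x.2.1 = Real.pi ∧ ‖x.2.2‖ = 1}

/-- Past null infinity of the universe `r > 0`. -/
def scriMinus₁ (d : ℕ) : Set (Coord d) :=
  {x | x.1 < 0 ∧ 0 < x.2.1 ∧ -x.1 + x.2.1 = Real.pi ∧ ‖x.2.2‖ = 1}

/-- Future null infinity of the universe `r < 0`. -/
def scriPlus₂ (d : ℕ) : Set (Coord d) :=
  {x | 0 < x.1 ∧ x.2.1 < 0 ∧ x.1 - x.2.1 = Real.pi ∧ ‖x.2.2‖ = 1}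

/-- Past null infinity of the universe `r < 0`. -/
def scriMinus₂ (d : ℕ) : Set (Coord d) :=
  {x | x.1 < 0 ∧ x.2.1 < 0 ∧ -x.1 - x.2.1 = Real.pi ∧ ‖x.2.2‖ = 1}

/-- The conformal compactification as a manifold with boundary: the points of `|T| ≤ π - |χ|` other
than `i^±` and the two `i^0`, where the sphere degenerates. -/
def compactification (d : ℕ) : Set (Coord d) :=
  bulk d ∪ (scriPlus₁ d ∪ scriMinus₁ d) ∪ (scriPlus₂ d ∪ scriMinus₂ d)

/-- `γ` restricted to `[0, 1]` is a smooth future-directed timelike curve from `x` to `y` in the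
compactification (signature `(+,-,…,-)`, time orientation `∂/∂T`). -/
def IsTimelikeCurve {d : ℕ} (a : ℝ) (γ : ℝ → Coord d) (x y : Coord d) : Prop :=
  ContDiffOn ℝ ∞ γ (Set.Icc 0 1) ∧ γ 0 = x ∧ γ 1 = y ∧
    ∀ s ∈ Set.Icc (0 : ℝ) 1, γ s ∈ compactification d ∧
      0 < (derivWithin γ (Set.Icc 0 1) s).1 ∧
      0 < confMetric a (γ s) (derivWithin γ (Set.Icc 0 1) s) (derivWithin γ (Set.Icc 0 1) s)

/-- `γ` restricted to `[0, 1]` is a smooth future-directed causal (timelike or null, with nonzero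
tangent) curve from `x` to `y` in the compactification. -/
def IsCausalCurve {d : ℕ} (a : ℝ) (γ : ℝ → Coord d) (x y : Coord d) : Prop :=
  ContDiffOn ℝ ∞ γ (Set.Icc 0 1) ∧ γ 0 = x ∧ γ 1 = y ∧
    ∀ s ∈ Set.Icc (0 : ℝ) 1, γ s ∈ compactification d ∧
      0 < (derivWithin γ (Set.Icc 0 1) s).1 ∧
      0 ≤ confMetric a (γ s) (derivWithin γ (Set.Icc 0 1) s) (derivWithin γ (Set.Icc 0 1) s)

/-- The timelike future `I⁺(x)` in the compactification. -/
def timelikeFuture {d : ℕ} (a : ℝ) (x : Coord d) : Set (Coord d) :=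
  {y | ∃ γ : ℝ → Coord d, IsTimelikeCurve a γ x y}

/-- The causal past `J⁻(y)` in the compactification, `y` itself included. -/
def causalPast {d : ℕ} (a : ℝ) (y : Coord d) : Set (Coord d) :=
  {x | x = y ∨ ∃ γ : ℝ → Coord d, IsCausalCurve a γ x y}

/-- `γ` is an affinely parametrized geodesic of the metric `g` on the interval `I`: it satisfies the
Euler–Lagrange equations of `½ g(γ', γ')`, that is
`d/ds g_γ(γ', w) = ½ (∂_w g)_γ(γ', γ')` at every parameter, for every vector `w` tangent to
`ℝ × ℝ × S^{d-1}` at that point. -/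
def IsGeodesicOn {d : ℕ} (g : Coord d → Coord d → Coord d → ℝ) (γ : ℝ → Coord d) (I : Set ℝ) :
    Prop :=
  ContDiffOn ℝ ∞ γ I ∧ ∀ s ∈ I, ‖(γ s).2.2‖ = 1 ∧
    ∀ w : Coord d, inner ℝ (γ s).2.2 w.2.2 = 0 →
      derivWithin (fun σ => g (γ σ) (derivWithin γ I σ) w) I s =
        (1 / 2) * deriv (fun ε : ℝ => g (γ s + ε • w) (derivWithin γ I s) (derivWithin γ I s)) 0

/-- Future-directed null geodesic of `g` on the interval `I`. -/
def IsNullGeodesicOn {d : ℕ} (g : Coord d → Coord d → Coord d → ℝ) (γ : ℝ → Coord d)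
    (I : Set ℝ) : Prop :=
  IsGeodesicOn g γ I ∧ ∀ s ∈ I, 0 < (derivWithin γ I s).1 ∧
    g (γ s) (derivWithin γ I s) (derivWithin γ I s) = 0

/-- `y` can be reached from `x` by a future-directed null geodesic segment of the compactification
(equivalently `x` can be reached from `y` by a past-pointing one). -/
def NullGeodesicConnected {d : ℕ} (a : ℝ) (x y : Coord d) : Prop :=
  ∃ γ : ℝ → Coord d, IsNullGeodesicOn (confMetric a) γ (Set.Icc 0 1) ∧
    Set.MapsTo γ (Set.Icc 0 1) (compactification d) ∧ γ 0 = x ∧ γ 1 = y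

/-- `γ` tends to `p` on the conformal boundary to the past. -/
def HasPastEndpoint {d : ℕ} (γ : ℝ → Coord d) (p : Coord d) : Prop :=
  Filter.Tendsto (fun s => compactify (γ s)) Filter.atBot (nhds p)

/-- `γ` tends to `x` on the conformal boundary to the future. -/
def HasFutureEndpoint {d : ℕ} (γ : ℝ → Coord d) (x : Coord d) : Prop :=
  Filter.Tendsto (fun s => compactify (γ s)) Filter.atTop (nhds x)

/-- `γ` is a complete null geodesic of the Ellis–Bronnikov spacetime that lies in the equatorial plane
cut out by the linear plane `P ⊆ ℝ^d`, has past endpoint `p`, and has impact parameter `R` (the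
smallest value of `r` along it). The spacetime is geodesically complete, so its inextendible
geodesics are those defined on `ℝ`. -/
def IsEquatorialRay {d : ℕ} (a : ℝ) (P : Submodule ℝ (EuclideanSpace ℝ (Fin d))) (p : Coord d)
    (R : ℝ) (γ : ℝ → Coord d) : Prop :=
  IsNullGeodesicOn (physMetric a) γ Set.univ ∧ (∀ s, (γ s).2.2 ∈ P) ∧ HasPastEndpoint γ p ∧
    IsLeast (Set.range fun s => (γ s).2.1) R

/-- The isometry that acts on the spheres by the reflection fixing the line through `ω₀`; on an
equatorial plane through `ω₀`, where `ω₀` has angle `0`, it is `φ ↦ -φ`. -/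
noncomputable def reflectAngle {d : ℕ} (ω₀ : EuclideanSpace ℝ (Fin d)) (x : Coord d) : Coord d :=
  (x.1, x.2.1, (Submodule.span ℝ {ω₀}).reflection x.2.2)

end Wormhole

namespace Wormhole

/-! Let `p` have direction n and advanced time v = t + r. Then q is the point of direction -n and
retarded time t - r = v; its T equals the χ of `p`. Claims 2 and 3 follow from one criterion: a
point x of future null infinity of the universe r > 0 is timelike reachable from `p` iff its
direction is not -n or its retarded time exceeds v.

Reachability (`mem_timelikeFuture`) uses explicit curves that imitate straight lines of flat space
passing at a distance of order K. If the swept angle is less than π, there is a margin of order K²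
that absorbs every effect of the throat. If the angle is π, the K² terms cancel, and the margin
comes from the terms of order K (u - v), where u is the retarded time of the endpoint.

The obstruction (`not_mem_timelikeFuture`) comes from the Einstein static universe: the coefficient
of dΩ² is at least sin² χ, so the map (χ, ω) ↦ (cos χ, sin χ ω) to the unit sphere of ℝ × ℝ^d sends
a timelike curve to one slower than T. An antipodal endpoint with elapsed T at most π lies at
distance exactly the elapsed T, which is therefore impossible.

On the boundary, T + χ cannot decrease along a causal curve and is maximal there, so a causal curve
that starts on future null infinity stays on one null generator (`eq_and_lt_of_isCausalCurve`).
Conversely the generators are null geodesics. Hence both past sets of q are the generator through q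
up to q.

The rays of claim 1 are solved by quadrature. With r = R cosh η, the affine parameter at unit energy
and the angle are integrals of smooth functions of η. A ray arrives with retarded time v + 2D after
an angle 2A, where D is `rayDelay` and A is `halfAngle`; comparison with flat space gives D → 0 and
A → π/2 as R → ∞. -/

/-! ### The argument of a planar vector as a smooth extension of the arctangent -/

theorem hasDerivAt_arg {x y : ℝ → ℝ} {x' y' s : ℝ} (hx : HasDerivAt x x' s)
    (hy : HasDerivAt y y' s) (h : 0 < x s ∨ y s ≠ 0) :
    HasDerivAt (fun s => Complex.arg ⟨x s, y s⟩)
      ((x s * y' - y s * x') / (x s ^ 2 + y s ^ 2)) s := by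
  have h1 : HasDerivAt (fun s => (⟨x s, y s⟩ : ℂ)) ⟨x', y'⟩ s := by
    have := hx.ofReal_comp.add (hy.ofReal_comp.mul_const Complex.I)
    have e1 : (⟨x', y'⟩ : ℂ) = x' + y' * Complex.I := by apply Complex.ext <;> simp
    have e2 : (fun s => (⟨x s, y s⟩ : ℂ)) = fun s => (x s : ℂ) + y s * Complex.I := by
      funext s; apply Complex.ext <;> simp
    rw [e1, e2]; exact this
  have h2 := h1.clog_real (Complex.mem_slitPlane_iff.2 h)
  have h3 : HasDerivAt (fun s => (Complex.log ⟨x s, y s⟩).im) _ s :=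
    Complex.imCLM.hasFDerivAt.comp_hasDerivAt s h2
  simp only [Complex.log_im] at h3
  refine (h3.congr_deriv ?_)
  simp [Complex.div_im, Complex.normSq_apply]
  ring

theorem contDiffAt_arg {x y : ℝ → ℝ} {s : ℝ} (hx : ContDiffAt ℝ ∞ x s)
    (hy : ContDiffAt ℝ ∞ y s) (h : 0 < x s ∨ y s ≠ 0) :
    ContDiffAt ℝ ∞ (fun s => Complex.arg ⟨x s, y s⟩) s := by
  have h1 : ContDiffAt ℝ ∞ (fun s => (⟨x s, y s⟩ : ℂ)) s := by
    have hx' : ContDiffAt ℝ ∞ (fun s => (x s : ℂ)) s :=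
      Complex.ofRealCLM.contDiff.contDiffAt.comp s hx
    have hy' : ContDiffAt ℝ ∞ (fun s => (y s : ℂ)) s :=
      Complex.ofRealCLM.contDiff.contDiffAt.comp s hy
    have := hx'.add (hy'.mul (contDiffAt_const (c := Complex.I)))
    convert this using 1
    funext s; apply Complex.ext <;> simp
  have h2 : ContDiffAt ℝ ∞ Complex.log (⟨x s, y s⟩ : ℂ) :=
    (Complex.contDiffAt_log (Complex.mem_slitPlane_iff.2 h)).restrict_scalars ℝ
  have h3 : ContDiffAt ℝ ∞ (fun s => (Complex.log ⟨x s, y s⟩).im) s :=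
    Complex.imCLM.contDiff.contDiffAt.comp (f := fun s => Complex.log ⟨x s, y s⟩) s
      (ContDiffAt.comp (g := Complex.log) (f := fun s => (⟨x s, y s⟩ : ℂ)) s h2 h1)
  simpa only [Complex.log_im] using h3

theorem cos_arg_mk {x y : ℝ} (h : 0 < x ∨ y ≠ 0) :
    Real.cos (Complex.arg ⟨x, y⟩) = x / Real.sqrt (x ^ 2 + y ^ 2) := by
  rw [Complex.cos_arg (Complex.slitPlane_ne_zero (Complex.mem_slitPlane_iff.2 h)),
    Complex.norm_def, Complex.normSq_apply]
  simp [sq]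

theorem sin_arg_mk (x y : ℝ) :
    Real.sin (Complex.arg ⟨x, y⟩) = y / Real.sqrt (x ^ 2 + y ^ 2) := by
  rw [Complex.sin_arg, Complex.norm_def, Complex.normSq_apply]
  simp [sq]

theorem arg_one_mk (y : ℝ) : Complex.arg ⟨1, y⟩ = Real.arctan y := by
  have h : |Complex.arg ⟨1, y⟩| < Real.pi / 2 := Complex.abs_arg_lt_pi_div_two_iff.2 (by simp)
  rw [abs_lt] at h
  rw [← Real.arctan_tan h.1 h.2, Complex.tan_arg]
  simp

theorem arg_zero_pos {y : ℝ} (hy : 0 < y) : Complex.arg ⟨0, y⟩ = Real.pi / 2 :=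
  Complex.arg_eq_pi_div_two_iff.2 ⟨rfl, hy⟩

theorem arg_zero_neg {y : ℝ} (hy : y < 0) : Complex.arg ⟨0, y⟩ = -(Real.pi / 2) := by
  have := Complex.arg_eq_neg_pi_div_two_iff (z := ⟨0, y⟩)
  rw [this.2 ⟨rfl, hy⟩]

theorem abs_arg_lt {x y : ℝ} (hx : 0 < x) : |Complex.arg ⟨x, y⟩| < Real.pi / 2 :=
  Complex.abs_arg_lt_pi_div_two_iff.2 (Or.inl hx)

/-! ### Reachable points: explicit timelike curves between null infinities -/

theorem norm_cos_add_sin {d : ℕ} {n e : EuclideanSpace ℝ (Fin d)} (hn : ‖n‖ = 1) (he : ‖e‖ = 1)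
    (hne : inner ℝ n e = 0) (θ : ℝ) : ‖Real.cos θ • n + Real.sin θ • e‖ = 1 := by
  have h : ‖Real.cos θ • n + Real.sin θ • e‖ ^ 2 = 1 := by
    rw [norm_add_sq_real, norm_smul, norm_smul, hn, he, inner_smul_left, inner_smul_right, hne]
    simp
  nlinarith [norm_nonneg (Real.cos θ • n + Real.sin θ • e)]

theorem bulk_of_null {d : ℕ} {V U : ℝ} {o : EuclideanSpace ℝ (Fin d)} (hV : |V| < Real.pi / 2)
    (hU : |U| < Real.pi / 2) (hom : ‖o‖ = 1) : ((V + U, V - U, o) : Coord d) ∈ bulk d := by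
  refine ⟨?_, hom⟩
  rw [abs_lt] at hV hU
  change |V + U| + |V - U| < Real.pi
  rcases abs_cases (V + U) with h | h <;> rcases abs_cases (V - U) with h' | h' <;> linarith

/-- The conformal coefficient of the round metric in terms of the null angles `V`, `U`. -/
theorem sphereCoeff_eq (a V U : ℝ) :
    Real.sin (V - U) ^ 2 + a ^ 2 * (Real.cos (V + U) + Real.cos (V - U)) ^ 2 =
      (Real.sin V * Real.cos U - Real.cos V * Real.sin U) ^ 2 +
        4 * a ^ 2 * (Real.cos V * Real.cos U) ^ 2 := by
  rw [Real.sin_sub, Real.cos_add, Real.cos_sub]; ring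

/-- A family of explicit timelike curves from past to future null infinity: in physical coordinates
`t + r = v + α z + 2 K z / (1 - z)`, `t - r = u + α (z - 1) - 2 K (1 - z) / z`, while the angle
runs from `0` to `l π`. -/
theorem mem_timelikeFuture_of_profile {d : ℕ} {n e : EuclideanSpace ℝ (Fin d)} (hn : ‖n‖ = 1)
    (he : ‖e‖ = 1) (hne : inner ℝ n e = 0) {a v u α K l : ℝ} (hK : 0 < K) (hα : 0 ≤ α)
    (H : ∀ z ∈ Set.Icc (0 : ℝ) 1,
      ((K * (z ^ 2 + (1 - z) ^ 2) + (v - u + α) / 2 * (z * (1 - z))) ^ 2 +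
          a ^ 2 * (z * (1 - z)) ^ 2) * (2 * l / (z ^ 2 + (1 - z) ^ 2)) ^ 2 <
        (α * (1 - z) ^ 2 + 2 * K) * (α * z ^ 2 + 2 * K)) :
    ((Real.pi / 2 + Real.arctan u, Real.pi / 2 - Real.arctan u,
        Real.cos (l * Real.pi) • n + Real.sin (l * Real.pi) • e) : Coord d) ∈
      timelikeFuture a (Real.arctan v - Real.pi / 2, Real.arctan v + Real.pi / 2, n) := by
  set N : ℝ → ℝ := fun z => (v + α * z) * (1 - z) + 2 * K * z with hN
  set M : ℝ → ℝ := fun z => z * (u + α * (z - 1)) - 2 * K * (1 - z) with hM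
  -- Here N = (1 - z)(t + r) and M = z (t - r). The arguments equal arctan (t ± r) in the interior
  -- and stay smooth at z = 1 and z = 0, where t + r and t - r become infinite.
  set V : ℝ → ℝ := fun z => Complex.arg ⟨1 - z, N z⟩ with hVdef
  set U : ℝ → ℝ := fun z => Complex.arg ⟨z, M z⟩ with hUdef
  -- The derivative 2l / (z² + (1 - z)²) cancels the leading part K (z² + (1 - z)²) of r z (1 - z),
  -- so that to order K² the hypothesis `H` reads l² < 1 for every z.
  set θ : ℝ → ℝ := fun z => 2 * l * (Real.arctan (2 * z - 1) + Real.pi / 4) with hθdef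
  set o : ℝ → EuclideanSpace ℝ (Fin d) := fun z => Real.cos (θ z) • n + Real.sin (θ z) • e with hom
  set γ : ℝ → Coord d := fun z => (V z + U z, V z - U z, o z) with hγ
  have cN : ∀ z ∈ Set.Icc (0 : ℝ) 1, 0 < 1 - z ∨ N z ≠ 0 := by
    intro z hz
    rcases lt_or_eq_of_le hz.2 with h | h
    · left; linarith
    · right; subst h; simp [hN]; positivity
  have cM : ∀ z ∈ Set.Icc (0 : ℝ) 1, 0 < z ∨ M z ≠ 0 := by
    intro z hz
    rcases lt_or_eq_of_le hz.1 with h | h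
    · left; linarith
    · right; subst h; simp [hM]; positivity
  have dN : ∀ z, HasDerivAt N (α * (1 - z) - (v + α * z) + 2 * K) z := by
    intro z
    have := ((((hasDerivAt_id z).const_mul α).const_add v).mul
      ((hasDerivAt_id z).const_sub 1)).add ((hasDerivAt_id z).const_mul (2 * K))
    refine this.congr_deriv ?_
    simp; ring
  have dM : ∀ z, HasDerivAt M (u + α * (z - 1) + z * α + 2 * K) z := by
    intro z
    have := ((hasDerivAt_id z).mul ((((hasDerivAt_id z).sub_const 1).const_mul α).const_add u)).sub
      (((hasDerivAt_id z).const_sub 1).const_mul (2 * K))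
    refine this.congr_deriv ?_
    simp
  set ρ : ℝ → ℝ := fun z => (1 - z) ^ 2 + N z ^ 2 with hρ
  set τ : ℝ → ℝ := fun z => z ^ 2 + M z ^ 2 with hτ
  have ρpos : ∀ z ∈ Set.Icc (0 : ℝ) 1, 0 < ρ z := by
    intro z hz
    rcases cN z hz with h | h
    · have := pow_pos h 2; positivity
    · positivity
  have τpos : ∀ z ∈ Set.Icc (0 : ℝ) 1, 0 < τ z := by
    intro z hz
    rcases cM z hz with h | h
    · positivity
    · positivity
  have dV : ∀ z ∈ Set.Icc (0 : ℝ) 1, HasDerivAt V ((α * (1 - z) ^ 2 + 2 * K) / ρ z) z := by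
    intro z hz
    refine (hasDerivAt_arg ((hasDerivAt_id z).const_sub 1) (dN z) (cN z hz)).congr_deriv ?_
    congr 1
    simp [hN]; ring
  have dU : ∀ z ∈ Set.Icc (0 : ℝ) 1, HasDerivAt U ((α * z ^ 2 + 2 * K) / τ z) z := by
    intro z hz
    refine (hasDerivAt_arg (hasDerivAt_id z) (dM z) (cM z hz)).congr_deriv ?_
    congr 1
    simp [hM]; ring
  have dθ : ∀ z, HasDerivAt θ (2 * l / (z ^ 2 + (1 - z) ^ 2)) z := by
    intro z
    have := (((((hasDerivAt_id z).const_mul 2).sub_const 1).arctan).add_const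
      (Real.pi / 4)).const_mul (2 * l)
    refine this.congr_deriv ?_
    have h1 : z ^ 2 + (1 - z) ^ 2 ≠ 0 := by nlinarith [sq_nonneg (2 * z - 1)]
    have h2 : 1 + (2 * z - 1) ^ 2 ≠ 0 := by nlinarith [sq_nonneg (2 * z - 1)]
    simp only [id]
    field_simp
    ring
  have dom : ∀ z, HasDerivAt o ((2 * l / (z ^ 2 + (1 - z) ^ 2)) •
      (-Real.sin (θ z) • n + Real.cos (θ z) • e)) z := by
    intro z
    refine (((dθ z).cos.smul_const n).add ((dθ z).sin.smul_const e)).congr_deriv ?_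
    rw [smul_add, smul_smul, smul_smul]
    congr 2 <;> ring
  have dγ : ∀ z ∈ Set.Icc (0 : ℝ) 1, derivWithin γ (Set.Icc 0 1) z =
      ((α * (1 - z) ^ 2 + 2 * K) / ρ z + (α * z ^ 2 + 2 * K) / τ z,
        (α * (1 - z) ^ 2 + 2 * K) / ρ z - (α * z ^ 2 + 2 * K) / τ z,
        (2 * l / (z ^ 2 + (1 - z) ^ 2)) • (-Real.sin (θ z) • n + Real.cos (θ z) • e)) := by
    intro z hz
    have := ((dV z hz).add (dU z hz)).prodMk (((dV z hz).sub (dU z hz)).prodMk (dom z))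
    exact this.hasDerivWithinAt.derivWithin (uniqueDiffOn_Icc zero_lt_one z hz)
  refine ⟨γ, ?_, ?_, ?_, ?_⟩
  · intro z hz
    refine ContDiffAt.contDiffWithinAt ?_
    have sV : ContDiffAt ℝ ∞ V z := contDiffAt_arg (by fun_prop) (by fun_prop) (cN z hz)
    have sU : ContDiffAt ℝ ∞ U z := contDiffAt_arg (by fun_prop) (by fun_prop) (cM z hz)
    have sθ : ContDiff ℝ ∞ θ := contDiff_const.mul
      ((Real.contDiff_arctan.comp (by fun_prop : ContDiff ℝ ∞ fun z : ℝ => 2 * z - 1)).add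
        contDiff_const)
    have som : ContDiff ℝ ∞ o := by fun_prop
    exact (sV.add sU).prodMk ((sV.sub sU).prodMk som.contDiffAt)
  · have h1 : V 0 = Real.arctan v := by simp [hVdef, hN, arg_one_mk]
    have h2 : U 0 = -(Real.pi / 2) := by
      simp only [hUdef, hM]; rw [arg_zero_neg]; simp; positivity
    have h3 : θ 0 = 0 := by simp [hθdef]
    simp only [hγ, hom, h1, h2, h3]
    simp [sub_eq_add_neg]
  · have h1 : U 1 = Real.arctan u := by simp [hUdef, hM, arg_one_mk]
    have h2 : V 1 = Real.pi / 2 := by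
      simp only [hVdef, hN, sub_self]; rw [arg_zero_pos]; simp; positivity
    have h3 : θ 1 = l * Real.pi := by simp [hθdef]; norm_num; ring
    simp only [hγ, hom, h1, h2, h3]
  · intro z hz
    have hw : ‖o z‖ = 1 := norm_cos_add_sin hn he hne _
    have hA : 0 < α * (1 - z) ^ 2 + 2 * K := by positivity
    have hB : 0 < α * z ^ 2 + 2 * K := by positivity
    have hr := ρpos z hz
    have ht := τpos z hz
    refine ⟨?_, ?_, ?_⟩
    · rcases eq_or_lt_of_le hz.1 with h0 | h0
      · left; right; right
        subst h0
        have h1 : V 0 = Real.arctan v := by simp [hVdef, hN, arg_one_mk]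
        have h2 : U 0 = -(Real.pi / 2) := by
          simp only [hUdef, hM]; rw [arg_zero_neg]; simp; positivity
        have := Real.arctan_lt_pi_div_two v
        have := Real.neg_pi_div_two_lt_arctan v
        refine ⟨?_, ?_, ?_, hw⟩ <;> simp only [hγ, h1, h2] <;> linarith
      rcases eq_or_lt_of_le hz.2 with h0' | h0'
      · left; right; left
        subst h0'
        have h1 : U 1 = Real.arctan u := by simp [hUdef, hM, arg_one_mk]
        have h2 : V 1 = Real.pi / 2 := by
          simp only [hVdef, hN, sub_self]; rw [arg_zero_pos]; simp; positivity
        have := Real.arctan_lt_pi_div_two u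
        have := Real.neg_pi_div_two_lt_arctan u
        refine ⟨?_, ?_, ?_, hw⟩ <;> simp only [hγ, h1, h2] <;> linarith
      · left; left
        exact bulk_of_null (abs_arg_lt (by linarith)) (abs_arg_lt h0) hw
    · rw [dγ z hz]; simp only; positivity
    · rw [dγ z hz]
      simp only [confMetric, hγ]
      rw [sphereCoeff_eq, inner_smul_left, inner_smul_right, real_inner_self_eq_norm_sq]
      have hdir : ‖-Real.sin (θ z) • n + Real.cos (θ z) • e‖ = 1 := by
        have := norm_cos_add_sin hn he hne (θ z + Real.pi / 2)
        rwa [Real.cos_add_pi_div_two, Real.sin_add_pi_div_two] at this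
      rw [hdir]
      simp only [hVdef, hUdef]
      rw [cos_arg_mk (cN z hz), cos_arg_mk (cM z hz), sin_arg_mk, sin_arg_mk]
      change 0 < _ - _ - ((N z / √(ρ z) * (z / √(τ z)) - (1 - z) / √(ρ z) * (M z / √(τ z))) ^ 2 +
        4 * a ^ 2 * ((1 - z) / √(ρ z) * (z / √(τ z))) ^ 2) * _
      have e1 : √(ρ z) ^ 2 = ρ z := Real.sq_sqrt hr.le
      have e2 : √(τ z) ^ 2 = τ z := Real.sq_sqrt ht.le
      have key := H z hz
      have e3 : N z * z - (1 - z) * M z =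
          2 * (K * (z ^ 2 + (1 - z) ^ 2) + (v - u + α) / 2 * (z * (1 - z))) := by
        simp only [hN, hM]; ring
      have e4 : (N z / √(ρ z) * (z / √(τ z)) - (1 - z) / √(ρ z) * (M z / √(τ z))) ^ 2 =
          (N z * z - (1 - z) * M z) ^ 2 / (ρ z * τ z) := by
        field_simp; rw [e1, e2]; ring
      have e5 : ((1 - z) / √(ρ z) * (z / √(τ z))) ^ 2 = (z * (1 - z)) ^ 2 / (ρ z * τ z) := by
        field_simp; rw [e1, e2]
      rw [e4, e5, e3]
      generalize ρ z = ρ0 at hr ⊢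
      generalize τ z = τ0 at ht ⊢
      generalize 2 * l / (z ^ 2 + (1 - z) ^ 2) = θ' at key ⊢
      generalize α * (1 - z) ^ 2 + 2 * K = A at key hA ⊢
      generalize α * z ^ 2 + 2 * K = B at key hB ⊢
      generalize K * (z ^ 2 + (1 - z) ^ 2) + (v - u + α) / 2 * (z * (1 - z)) = C at key ⊢
      -- In null coordinates dT² - dχ² = 4 dV dU, and all terms share the conformal factor 1 / (ρ
      -- τ); what remains is `H`.
      have : (A / ρ0 + B / τ0) * (A / ρ0 + B / τ0) - (A / ρ0 - B / τ0) * (A / ρ0 - B / τ0) -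
          ((2 * C) ^ 2 / (ρ0 * τ0) + 4 * a ^ 2 * ((z * (1 - z)) ^ 2 / (ρ0 * τ0))) *
            ((starRingEnd ℝ) θ' * (θ' * 1 ^ 2)) =
          4 * (A * B - (C ^ 2 + a ^ 2 * (z * (1 - z)) ^ 2) * θ' ^ 2) / (ρ0 * τ0) := by
        simp only [conj_trivial]
        field_simp; ring
      rw [this]
      have : 0 < A * B - (C ^ 2 + a ^ 2 * (z * (1 - z)) ^ 2) * θ' ^ 2 := by linarith
      positivity

theorem exists_unit_orthogonal {E : Type*} [NormedAddCommGroup E] [InnerProductSpace ℝ E]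
    (P : Submodule ℝ E) (hP : 2 ≤ Module.finrank ℝ P) {n : E} (hn : ‖n‖ = 1) (hnP : n ∈ P) :
    ∃ e ∈ P, ‖e‖ = 1 ∧ inner ℝ n e = 0 := by
  obtain ⟨y, hyP, hy⟩ : ∃ y ∈ P, y ∉ Submodule.span ℝ {n} := by
    by_contra! h
    have h1 : P ≤ Submodule.span ℝ {n} := h
    have h2 := Submodule.finrank_mono h1
    have h3 := finrank_span_le_card (R := ℝ) ({n} : Set E)
    simp at h3
    omega
  set z := y - (inner ℝ n y : ℝ) • n with hz
  have hz0 : z ≠ 0 := by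
    intro h
    apply hy
    rw [Submodule.mem_span_singleton]
    exact ⟨_, (sub_eq_zero.1 h).symm⟩
  refine ⟨‖z‖⁻¹ • z, P.smul_mem _ (P.sub_mem hyP (P.smul_mem _ hnP)), norm_smul_inv_norm hz0, ?_⟩
  rw [inner_smul_right, hz, inner_sub_right, inner_smul_right, real_inner_self_eq_norm_sq, hn]
  ring

theorem exists_angle {d : ℕ} (hd : 2 ≤ d) {n m : EuclideanSpace ℝ (Fin d)} (hn : ‖n‖ = 1)
    (hm : ‖m‖ = 1) : ∃ e : EuclideanSpace ℝ (Fin d), ‖e‖ = 1 ∧ inner ℝ n e = 0 ∧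
      ∃ l : ℝ, 0 ≤ l ∧ l ≤ 1 ∧ m = Real.cos (l * Real.pi) • n + Real.sin (l * Real.pi) • e := by
  have hc := abs_le.1 (abs_real_inner_le_norm n m)
  rw [hn, hm, mul_one] at hc
  set c : ℝ := inner ℝ n m with hcdef
  have hnorm : ‖m - c • n‖ ^ 2 = 1 - c ^ 2 := by
    rw [norm_sub_sq_real, inner_smul_right, real_inner_comm, ← hcdef, norm_smul, hm, hn,
      Real.norm_eq_abs, mul_one, sq_abs]
    ring
  have hl : Real.arccos c / Real.pi * Real.pi = Real.arccos c := by field_simp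
  have hcos : Real.cos (Real.arccos c / Real.pi * Real.pi) = c := by
    rw [hl, Real.cos_arccos hc.1 hc.2]
  have hsin : Real.sin (Real.arccos c / Real.pi * Real.pi) = ‖m - c • n‖ := by
    rw [hl, Real.sin_arccos, ← hnorm, Real.sqrt_sq (norm_nonneg _)]
  have h0 : 0 ≤ Real.arccos c / Real.pi := div_nonneg (Real.arccos_nonneg c) Real.pi_pos.le
  have h1 : Real.arccos c / Real.pi ≤ 1 := (div_le_one Real.pi_pos).2 (Real.arccos_le_pi c)
  -- If m = ±n the plane of rotation is not determined, and any unit vector orthogonal to n serves.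
  by_cases hz : m - c • n = 0
  · obtain ⟨e, -, he, hne⟩ := exists_unit_orthogonal (⊤ : Submodule ℝ (EuclideanSpace ℝ (Fin d)))
      (by simpa using hd) hn trivial
    refine ⟨e, he, hne, _, h0, h1, ?_⟩
    rw [hcos, hsin, hz, norm_zero, zero_smul, add_zero]
    exact sub_eq_zero.1 hz
  · refine ⟨‖m - c • n‖⁻¹ • (m - c • n), norm_smul_inv_norm hz, ?_, _, h0, h1, ?_⟩
    · rw [inner_smul_right, inner_sub_right, inner_smul_right, real_inner_self_eq_norm_sq, hn,
        ← hcdef]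
      ring
    · rw [hcos, hsin, smul_smul, mul_inv_cancel₀ (norm_ne_zero_iff.2 hz)]
      module

/-- For l < 1 the profile condition compares about 4K² l² with 4K², so a large K wins whatever v, u
and a are: the curve goes around far out, close to spatial infinity. -/
theorem mem_timelikeFuture_of_angle_lt {d : ℕ} {n e : EuclideanSpace ℝ (Fin d)} (hn : ‖n‖ = 1)
    (he : ‖e‖ = 1) (hne : inner ℝ n e = 0) (a v u : ℝ) {l : ℝ} (hl0 : 0 ≤ l) (hl : l < 1) :
    ((Real.pi / 2 + Real.arctan u, Real.pi / 2 - Real.arctan u,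
        Real.cos (l * Real.pi) • n + Real.sin (l * Real.pi) • e) : Coord d) ∈
      timelikeFuture a (Real.arctan v - Real.pi / 2, Real.arctan v + Real.pi / 2, n) := by
  set c := (v - u) / 2 with hc
  set B := |c| / 2 + |a| / 2 with hB
  have hB0 : 0 ≤ B := by positivity
  have hl' : 0 < 1 - l := by linarith
  -- B bounds the errors from the offset c and from the throat, since w / (1 - 2w) ≤ 1/2; K is
  -- chosen so that (K + B) l < K.
  set K := B * l / (1 - l) + 1 with hK
  have hK0 : 0 < K := by positivity
  have hKl : (K + B) * l < K := by
    have : K * (1 - l) = B * l + (1 - l) := by rw [hK]; field_simp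
    linarith
  clear_value K B
  refine mem_timelikeFuture_of_profile hn he hne (α := 0) (K := K) hK0 le_rfl ?_
  intro z hz
  have hw0 : 0 ≤ z * (1 - z) := mul_nonneg hz.1 (by linarith [hz.2])
  have hm : z ^ 2 + (1 - z) ^ 2 = 1 - 2 * (z * (1 - z)) := by ring
  have hw : z * (1 - z) ≤ 1 / 4 := by nlinarith [sq_nonneg (2 * z - 1)]
  rw [hm, add_zero, ← hc]
  generalize z * (1 - z) = w at *
  have hm0 : 0 < 1 - 2 * w := by linarith
  have ht : w / (1 - 2 * w) ≤ 1 / 2 := by rw [div_le_iff₀ hm0]; linarith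
  have ht0 : 0 ≤ w / (1 - 2 * w) := by positivity
  have e : ((K * (1 - 2 * w) + c * w) ^ 2 + a ^ 2 * w ^ 2) * (2 * l / (1 - 2 * w)) ^ 2 =
      4 * l ^ 2 * ((K + c * (w / (1 - 2 * w))) ^ 2 + a ^ 2 * (w / (1 - 2 * w)) ^ 2) := by
    field_simp; ring
  rw [e]
  generalize w / (1 - 2 * w) = t at *
  have h1 : (K + c * t) ^ 2 ≤ (K + |c| / 2) ^ 2 := by
    apply sq_le_sq'
    · nlinarith [neg_abs_le c, abs_nonneg c]
    · nlinarith [le_abs_self c, abs_nonneg c]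
  have h2 : a ^ 2 * t ^ 2 ≤ (|a| / 2) ^ 2 := by
    rw [← sq_abs a, ← mul_pow]
    apply pow_le_pow_left₀ (by positivity)
    nlinarith [abs_nonneg a]
  have h3 : (K + c * t) ^ 2 + a ^ 2 * t ^ 2 ≤ (K + B) ^ 2 := by
    have : 0 ≤ (K + |c| / 2) * |a| := by positivity
    have : (K + B) ^ 2 = (K + |c| / 2) ^ 2 + (|a| / 2) ^ 2 + (K + |c| / 2) * |a| := by
      rw [hB]; ring
    linarith
  have h4 : ((K + B) * l) ^ 2 < K ^ 2 := pow_lt_pow_left₀ hKl (by positivity) two_ne_zero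
  have h5 := mul_le_mul_of_nonneg_left h3 (sq_nonneg l)
  rw [mul_pow] at h4
  linarith

/-- For l = 1 the terms 4K² cancel. Half of the spare time u - v is spent on α, which speeds up both
null coordinates, and the other half leaves the offset -k/2 in r; both contribute to order K with
the favourable sign. -/
theorem mem_timelikeFuture_of_antipodal {d : ℕ} {n e : EuclideanSpace ℝ (Fin d)} (hn : ‖n‖ = 1)
    (he : ‖e‖ = 1) (hne : inner ℝ n e = 0) (a : ℝ) {v u : ℝ} (huv : v < u) :
    ((Real.pi / 2 + Real.arctan u, Real.pi / 2 - Real.arctan u, -n) : Coord d) ∈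
      timelikeFuture a (Real.arctan v - Real.pi / 2, Real.arctan v + Real.pi / 2, n) := by
  set k := (u - v) / 2 with hk
  have hk0 : 0 < k := by linarith
  -- With K k = k² + 4a² =: S the error S t² is absorbed by the gain 4 S t, because 0 ≤ t ≤ 1/2.
  set K := (k ^ 2 + 4 * a ^ 2) / k with hK
  have hK0 : 0 < K := by positivity
  have hKk : K * k = k ^ 2 + 4 * a ^ 2 := by rw [hK]; field_simp
  have := mem_timelikeFuture_of_profile hn he hne (a := a) (v := v) (u := u) (l := 1) (α := k)
    hK0 hk0.le ?_
  · simpa using this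
  intro z hz
  have hw0 : 0 ≤ z * (1 - z) := mul_nonneg hz.1 (by linarith [hz.2])
  have hm : z ^ 2 + (1 - z) ^ 2 = 1 - 2 * (z * (1 - z)) := by ring
  have hw : z * (1 - z) ≤ 1 / 4 := by nlinarith [sq_nonneg (2 * z - 1)]
  have hc : (v - u + k) / 2 = -(k / 2) := by rw [hk]; ring
  have hR : (k * (1 - z) ^ 2 + 2 * K) * (k * z ^ 2 + 2 * K) =
      4 * K ^ 2 + 2 * (K * k) * (1 - 2 * (z * (1 - z))) + k ^ 2 * (z * (1 - z)) ^ 2 := by ring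
  rw [hm, hc, hR]
  generalize z * (1 - z) = w at *
  have hm0 : 0 < 1 - 2 * w := by linarith
  have ht : w / (1 - 2 * w) ≤ 1 / 2 := by rw [div_le_iff₀ hm0]; linarith
  have ht0 : 0 ≤ w / (1 - 2 * w) := by positivity
  have e : ((K * (1 - 2 * w) + -(k / 2) * w) ^ 2 + a ^ 2 * w ^ 2) * (2 * 1 / (1 - 2 * w)) ^ 2 =
      4 * K ^ 2 - 4 * (K * k) * (w / (1 - 2 * w)) +
        (k ^ 2 + 4 * a ^ 2) * (w / (1 - 2 * w)) ^ 2 := by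
    field_simp; ring
  rw [e, hKk]
  generalize w / (1 - 2 * w) = t at *
  have hs : 0 < k ^ 2 + 4 * a ^ 2 := by positivity
  have hk2 : 0 ≤ k ^ 2 * w ^ 2 := by positivity
  generalize k ^ 2 + 4 * a ^ 2 = S at *
  have h1 : S * t ^ 2 ≤ S * t := by
    apply mul_le_mul_of_nonneg_left _ hs.le; nlinarith
  nlinarith [mul_nonneg hs.le ht0]

theorem mem_timelikeFuture {d : ℕ} (hd : 2 ≤ d) (a : ℝ) {p x : Coord d} (hp : p ∈ scriMinus₁ d)
    (hx : x ∈ scriPlus₁ d) (h : x.2.2 ≠ -p.2.2 ∨ p.2.1 < x.1) : x ∈ timelikeFuture a p := by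
  obtain ⟨T, χ, n⟩ := p
  obtain ⟨T', χ', m⟩ := x
  obtain ⟨h1, h2, h3, hn⟩ := hp
  obtain ⟨k1, k2, k3, hm⟩ := hx
  simp only at h1 h2 h3 hn k1 k2 k3 hm h
  have av : Real.arctan (Real.tan (χ - Real.pi / 2)) = χ - Real.pi / 2 :=
    Real.arctan_tan (by linarith) (by linarith)
  have au : Real.arctan (Real.tan (T' - Real.pi / 2)) = T' - Real.pi / 2 :=
    Real.arctan_tan (by linarith) (by linarith)
  have ep : ((T, χ, n) : Coord d) = (Real.arctan (Real.tan (χ - Real.pi / 2)) - Real.pi / 2,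
      Real.arctan (Real.tan (χ - Real.pi / 2)) + Real.pi / 2, n) := by
    rw [av]; refine Prod.ext ?_ (Prod.ext ?_ rfl) <;> simp only <;> linarith
  have ex : ((T', χ', m) : Coord d) = (Real.pi / 2 + Real.arctan (Real.tan (T' - Real.pi / 2)),
      Real.pi / 2 - Real.arctan (Real.tan (T' - Real.pi / 2)), m) := by
    rw [au]; refine Prod.ext ?_ (Prod.ext ?_ rfl) <;> simp only <;> linarith
  obtain ⟨e, he, hne, l, hl0, hl1, rfl⟩ := exists_angle hd hn hm
  rw [ep, ex]
  rcases lt_or_eq_of_le hl1 with hl | rfl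
  · exact mem_timelikeFuture_of_angle_lt hn he hne _ _ _ hl0 hl
  · have hanti : Real.cos (1 * Real.pi) • n + Real.sin (1 * Real.pi) • e = -n := by simp
    rw [hanti] at h ⊢
    have hlt : χ < T' := h.resolve_left (fun h => h rfl)
    refine mem_timelikeFuture_of_antipodal hn he hne a ?_
    rw [← Real.arctan_lt_arctan_iff, av, au]
    linarith

/-! ### Unreachable points: comparison with the Einstein static universe -/

theorem hasDerivWithinAt_components {d : ℕ} {γ : ℝ → Coord d} {I : Set ℝ}
    (h : ContDiffOn ℝ ∞ γ I) {s : ℝ} (hs : s ∈ I) :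
    HasDerivWithinAt (fun s => (γ s).1) (derivWithin γ I s).1 I s ∧
      HasDerivWithinAt (fun s => (γ s).2.1) (derivWithin γ I s).2.1 I s ∧
      HasDerivWithinAt (fun s => (γ s).2.2) (derivWithin γ I s).2.2 I s := by
  have h1 := ((h.differentiableOn (by simp)) s hs).hasDerivWithinAt
  have h2 : HasDerivWithinAt (fun s => (γ s).2) (derivWithin γ I s).2 I s :=
    (hasFDerivAt_snd (𝕜 := ℝ) (p := γ s)).comp_hasDerivWithinAt s h1
  exact ⟨(hasFDerivAt_fst (𝕜 := ℝ) (p := γ s)).comp_hasDerivWithinAt s h1,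
    (ContinuousLinearMap.fst ℝ ℝ (EuclideanSpace ℝ (Fin d))).hasFDerivAt.comp_hasDerivWithinAt s h2,
    (ContinuousLinearMap.snd ℝ ℝ (EuclideanSpace ℝ (Fin d))).hasFDerivAt.comp_hasDerivWithinAt s
      h2⟩

theorem norm_of_mem_compactification {d : ℕ} {x : Coord d} (h : x ∈ compactification d) :
    ‖x.2.2‖ = 1 := by
  rcases h with (h | h | h) | h | h
  exacts [h.2, h.2.2.2, h.2.2.2, h.2.2.2, h.2.2.2]

theorem add_le_pi_of_mem_compactification {d : ℕ} {x : Coord d} (h : x ∈ compactification d) :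
    x.1 + x.2.1 ≤ Real.pi := by
  rcases h with (h | h | h) | h | h
  · linarith [h.1, le_abs_self x.1, le_abs_self x.2.1]
  all_goals obtain ⟨h1, h2, h3, -⟩ := h; linarith

theorem mem_scriPlus₁_of_add_eq_pi {d : ℕ} {x : Coord d} (h : x ∈ compactification d)
    (hx : x.1 + x.2.1 = Real.pi) : x ∈ scriPlus₁ d := by
  rcases h with (h | h | h) | h | h
  · linarith [h.1, le_abs_self x.1, le_abs_self x.2.1]
  · exact h
  all_goals obtain ⟨h1, h2, h3, -⟩ := h; exfalso; linarith

theorem inner_derivWithin_eq_zero {E : Type*} [NormedAddCommGroup E] [InnerProductSpace ℝ E]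
    {c : ℝ → E} {c' : E} {I : Set ℝ} {s : ℝ} (hI : UniqueDiffWithinAt ℝ I s) (hs : s ∈ I)
    (hc : HasDerivWithinAt c c' I s) (h1 : ∀ s ∈ I, ‖c s‖ = 1) : inner ℝ (c s) c' = 0 := by
  have h2 := hc.inner ℝ hc
  have h3 : HasDerivWithinAt (fun s => (inner ℝ (c s) (c s) : ℝ)) 0 I s :=
    (hasDerivWithinAt_const s I (1 : ℝ)).congr
      (fun y hy => by rw [real_inner_self_eq_norm_sq, h1 y hy]; norm_num)
      (by rw [real_inner_self_eq_norm_sq, h1 s hs]; norm_num)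
  have h4 := hI.eq_deriv _ h2 h3
  rw [real_inner_comm c' (c s)] at h4
  rw [real_inner_comm]
  linarith

/-- The gradient on the sphere of the height y = ⟨n, w⟩ is n - y w, of squared length 1 - y²;
Cauchy–Schwarz does the rest. -/
theorem inner_sq_le_of_orthogonal {E : Type*} [NormedAddCommGroup E] [InnerProductSpace ℝ E]
    {n w w' : E} (hn : ‖n‖ = 1) (hw : ‖w‖ = 1) (h : inner ℝ w w' = 0) :
    (inner ℝ n w' : ℝ) ^ 2 ≤ (1 - (inner ℝ n w : ℝ) ^ 2) * ‖w'‖ ^ 2 := by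
  set y : ℝ := inner ℝ n w with hy
  have h1 : ‖n - y • w‖ ^ 2 = 1 - y ^ 2 := by
    rw [norm_sub_sq_real, inner_smul_right, ← hy, norm_smul, hw, hn, Real.norm_eq_abs, mul_one,
      sq_abs]
    ring
  have h2 : (inner ℝ n w' : ℝ) = inner ℝ (n - y • w) w' := by
    rw [inner_sub_left, inner_smul_left, h]; simp
  rw [h2, ← h1, ← mul_pow, ← sq_abs]
  exact pow_le_pow_left₀ (abs_nonneg _) (abs_real_inner_le_norm _ _) 2

/-- Cauchy–Schwarz for the cosine of a distance on the larger sphere: the left side is the square of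
its derivative, the first factor on the right the squared gradient, the second the squared speed. -/
theorem sphere_speed_bound {A B X S y y' W : ℝ} (hy : y' ^ 2 ≤ (1 - y ^ 2) * W ^ 2)
    (hy1 : 0 ≤ 1 - y ^ 2) :
    (A * X + B * S * y') ^ 2 ≤ (A ^ 2 + B ^ 2 * (1 - y ^ 2)) * (X ^ 2 + S ^ 2 * W ^ 2) := by
  obtain ⟨Y, hY0, hY⟩ : ∃ Y : ℝ, 0 ≤ Y ∧ Y ^ 2 = 1 - y ^ 2 :=
    ⟨√(1 - y ^ 2), Real.sqrt_nonneg _, Real.sq_sqrt hy1⟩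
  rw [← hY] at hy ⊢
  have h1 : |y'| ≤ Y * |W| := by
    apply abs_le_of_sq_le_sq' _ (by positivity) |> abs_le.2
    rw [mul_pow, sq_abs]; exact hy
  have h2 : A * X * (B * S) * y' ≤ |A * X * (B * S)| * (Y * |W|) :=
    (le_abs_self _).trans (by rw [abs_mul]; gcongr)
  have h3 : |A * X * (B * S)| * (Y * |W|) = |A * S * W| * |B * Y * X| := by
    simp only [abs_mul, abs_of_nonneg hY0]; ring
  have h4 : 2 * (|A * S * W| * |B * Y * X|) ≤ (A * S * W) ^ 2 + (B * Y * X) ^ 2 := by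
    rw [← sq_abs (A * S * W), ← sq_abs (B * Y * X)]
    nlinarith [sq_nonneg (|A * S * W| - |B * Y * X|)]
  have h5 := mul_le_mul_of_nonneg_left hy (sq_nonneg (B * S))
  nlinarith

/-- A curve on the unit sphere that is slower than `T` stays within angle `T + c` of a base point;
`f` is the cosine of the distance to that point. -/
theorem cos_le_of_slow {f T f' T' : ℝ → ℝ} {s₀ s₁ c : ℝ}
    (hf : ∀ s ∈ Set.Icc s₀ s₁, HasDerivWithinAt f (f' s) (Set.Icc s₀ s₁) s)
    (hT : ∀ s ∈ Set.Icc s₀ s₁, HasDerivWithinAt T (T' s) (Set.Icc s₀ s₁) s)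
    (hc : ∀ s ∈ Set.Ico s₀ s₁, 0 < T s + c ∧ T s + c < Real.pi)
    (hb : ∀ s ∈ Set.Icc s₀ s₁, ∀ θ, 0 < θ → θ < Real.pi → f s = Real.cos θ →
      -(Real.sin θ * T' s) < f' s)
    (h0 : Real.cos (T s₀ + c) ≤ f s₀) : ∀ s ∈ Set.Icc s₀ s₁, Real.cos (T s + c) ≤ f s := by
  have hB : ∀ s ∈ Set.Icc s₀ s₁, HasDerivWithinAt (fun s => -Real.cos (T s + c))
      (Real.sin (T s + c) * T' s) (Set.Icc s₀ s₁) s := by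
    intro s hs
    refine (((hT s hs).add_const c).cos.neg).congr_deriv ?_
    ring
  have right : ∀ {g : ℝ → ℝ} {g' s : ℝ}, s ∈ Set.Ico s₀ s₁ →
      HasDerivWithinAt g g' (Set.Icc s₀ s₁) s → HasDerivWithinAt g g' (Set.Ici s) s :=
    fun hs h => h.mono_of_mem_nhdsWithin (Icc_mem_nhdsGE_of_mem hs)
  -- The comparison principle needs the strict inequality of derivatives only at contact points.
  -- There f is the cosine of T + c, which lies in (0, π).
  have key := image_le_of_deriv_right_lt_deriv_boundary' (f := fun s => -f s)
    (f' := fun s => -f' s) (a := s₀) (b := s₁) (B := fun s => -Real.cos (T s + c))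
    (B' := fun s => Real.sin (T s + c) * T' s)
    (fun s hs => (hf s hs).neg.continuousWithinAt)
    (fun s hs => right hs (hf s (Set.Ico_subset_Icc_self hs)).neg) (by simpa using h0)
    (fun s hs => (hB s hs).continuousWithinAt)
    (fun s hs => right hs (hB s (Set.Ico_subset_Icc_self hs)))
    (fun s hs h => by
      have := hb s (Set.Ico_subset_Icc_self hs) (T s + c) (hc s hs).1 (hc s hs).2
        (neg_injective h)
      linarith)
  intro s hs
  have := key hs
  simpa using this

/-- The angle form of "distance < elapsed time". Working with cosines avoids the singularities of
arccos at distances 0 and π, but the comparison then degenerates at both ends, where the sine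
vanishes. Shifts of T by small constants repair this. -/
theorem cos_lt_of_slow {f T f' T' : ℝ → ℝ}
    (hf : ∀ s ∈ Set.Icc (0 : ℝ) 1, HasDerivWithinAt f (f' s) (Set.Icc 0 1) s)
    (hT : ∀ s ∈ Set.Icc (0 : ℝ) 1, HasDerivWithinAt T (T' s) (Set.Icc 0 1) s)
    (hT' : ∀ s ∈ Set.Icc (0 : ℝ) 1, 0 < T' s)
    (hb : ∀ s ∈ Set.Icc (0 : ℝ) 1, ∀ θ, 0 < θ → θ < Real.pi → f s = Real.cos θ →
      -(Real.sin θ * T' s) < f' s)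
    (h0 : f 0 = 1) (h1 : T 1 - T 0 ≤ Real.pi) : Real.cos (T 1 - T 0) < f 1 := by
  have hmono : StrictMonoOn T (Set.Icc 0 1) := by
    apply strictMonoOn_of_hasDerivWithinAt_pos (convex_Icc 0 1)
      (fun s hs => (hT s hs).continuousWithinAt) (f' := T')
    · intro s hs
      exact (hT s (interior_subset hs)).mono interior_subset
    · intro s hs
      exact hT' s (interior_subset hs)
  have sub : ∀ {g : ℝ → ℝ} {g' s s₀ s₁ : ℝ}, 0 ≤ s₀ → s₁ ≤ 1 →
      HasDerivWithinAt g g' (Set.Icc 0 1) s → HasDerivWithinAt g g' (Set.Icc s₀ s₁) s :=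
    fun a b h => h.mono (Set.Icc_subset_Icc a b)
  have z0 : (0 : ℝ) ∈ Set.Icc (0 : ℝ) 1 := by norm_num
  have z1 : (1 : ℝ) ∈ Set.Icc (0 : ℝ) 1 := by norm_num
  have zh : (1 / 2 : ℝ) ∈ Set.Icc (0 : ℝ) 1 := by norm_num
  have zq : (3 / 4 : ℝ) ∈ Set.Icc (0 : ℝ) 1 := by norm_num
  have hq : T (3 / 4) < T 1 := hmono zq z1 (by norm_num)
  have weak : ∀ s ∈ Set.Icc (0 : ℝ) (3 / 4), Real.cos (T s - T 0) ≤ f s := by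
    intro s hs
    -- The shift ε > 0 moves the starting angle off 0. Stopping at 3/4 keeps the shifted angle below
    -- π.
    have hev : ∀ᶠ ε in nhdsWithin (0 : ℝ) (Set.Ioi 0), Real.cos (T s + (-T 0 + ε)) ≤ f s := by
      filter_upwards [Ioo_mem_nhdsGT (show (0 : ℝ) < T 1 - T (3 / 4) by linarith)] with ε hε
      refine cos_le_of_slow (s₀ := 0) (s₁ := 3 / 4) (f' := f') (T' := T')
        (fun s hs => sub le_rfl (by norm_num) (hf s ⟨hs.1, by linarith [hs.2]⟩))
        (fun s hs => sub le_rfl (by norm_num) (hT s ⟨hs.1, by linarith [hs.2]⟩)) ?_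
        (fun s hs => hb s ⟨hs.1, by linarith [hs.2]⟩) (by rw [h0]; exact Real.cos_le_one _) s hs
      intro r hr
      have a1 := hmono.monotoneOn z0 ⟨hr.1, by linarith [hr.2]⟩ hr.1
      have a2 := hmono.monotoneOn ⟨hr.1, by linarith [hr.2]⟩ zq hr.2.le
      exact ⟨by linarith [hε.1], by linarith [hε.2]⟩
    have hlim : Filter.Tendsto (fun ε : ℝ => Real.cos (T s + (-T 0 + ε)))
        (nhdsWithin (0 : ℝ) (Set.Ioi 0)) (nhds (Real.cos (T s + (-T 0 + 0)))) := by
      apply Filter.Tendsto.mono_left _ nhdsWithin_le_nhds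
      exact Continuous.tendsto (by fun_prop) 0
    have := le_of_tendsto hlim hev
    rwa [add_zero, ← sub_eq_add_neg] at this
  have t0 : T 0 < T (1 / 2) := hmono z0 zh (by norm_num)
  have t1 : T (1 / 2) < T 1 := hmono zh z1 (by norm_num)
  -- Equality would be an interior minimum of the difference, whose derivative is positive there by
  -- `hb`.
  have strict : Real.cos (T (1 / 2) - T 0) < f (1 / 2) := by
    refine lt_of_le_of_ne (weak _ (by norm_num)) fun heq => ?_
    have hnb : Set.Icc (0 : ℝ) 1 ∈ nhds (1 / 2 : ℝ) := Icc_mem_nhds (by norm_num) (by norm_num)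
    have hd := ((hf _ zh).hasDerivAt hnb).sub (((hT _ zh).hasDerivAt hnb).sub_const (T 0)).cos
    have hmin : IsLocalMin (f - fun s => Real.cos (T s - T 0)) (1 / 2) := by
      filter_upwards [Icc_mem_nhds (show (0 : ℝ) < 1 / 2 by norm_num)
        (show (1 / 2 : ℝ) < 3 / 4 by norm_num)] with s hs
      have := weak s hs
      simp only [Pi.sub_apply, heq]
      linarith
    have := hmin.hasDerivAt_eq_zero hd
    have h2 := hb _ zh (T (1 / 2) - T 0) (by linarith) (by linarith) heq.symm
    linarith
  -- The strictness at 1/2 is turned into a lead δ in angle. The comparison then carries the lead to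
  -- the endpoint, where it gives the strict inequality even for elapsed time π.
  obtain ⟨δ, hδ0, hδ1, hδ⟩ : ∃ δ, 0 < δ ∧ δ < T (1 / 2) - T 0 ∧
      Real.cos (T (1 / 2) + (-T 0 - δ)) ≤ f (1 / 2) := by
    have hlim : Filter.Tendsto (fun ε : ℝ => Real.cos (T (1 / 2) + (-T 0 - ε)))
        (nhdsWithin (0 : ℝ) (Set.Ioi 0)) (nhds (Real.cos (T (1 / 2) + (-T 0 - 0)))) := by
      apply Filter.Tendsto.mono_left _ nhdsWithin_le_nhds
      exact Continuous.tendsto (by fun_prop) 0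
    rw [sub_zero, ← sub_eq_add_neg] at hlim
    obtain ⟨δ, h1, h2⟩ := ((hlim.eventually_lt_const strict).and
      (Ioo_mem_nhdsGT (show (0 : ℝ) < T (1 / 2) - T 0 by linarith))).exists
    exact ⟨δ, h2.1, h2.2, h1.le⟩
  have fin := cos_le_of_slow (s₀ := 1 / 2) (s₁ := 1) (f' := f') (T' := T')
    (fun s hs => sub (by norm_num) le_rfl (hf s ⟨by linarith [hs.1], hs.2⟩))
    (fun s hs => sub (by norm_num) le_rfl (hT s ⟨by linarith [hs.1], hs.2⟩))
    (fun r hr => by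
      have a1 := hmono.monotoneOn zh ⟨by linarith [hr.1], hr.2.le⟩ hr.1
      have a2 := hmono ⟨by linarith [hr.1], hr.2.le⟩ z1 hr.2
      exact ⟨by linarith, by linarith⟩)
    (fun s hs => hb s ⟨by linarith [hs.1], hs.2⟩) hδ 1 (by norm_num)
  refine lt_of_lt_of_le ?_ fin
  apply Real.cos_lt_cos_of_nonneg_of_le_pi <;> linarith

/-- Projected to the sphere by (cos χ, sin χ ω), a timelike curve covers a distance less than the
elapsed T. The map is smooth for χ of either sign, so crossings of the throat need no separate
treatment. -/
theorem not_mem_timelikeFuture {d : ℕ} {a : ℝ} {p x : Coord d} (hp : p ∈ scriMinus₁ d)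
    (hx : x ∈ scriPlus₁ d) (hax : x.2.2 = -p.2.2) (hT : x.1 ≤ p.2.1) :
    x ∉ timelikeFuture a p := by
  rintro ⟨γ, hγ, rfl, rfl, h⟩
  obtain ⟨p1, p2, p3, hn⟩ := hp
  obtain ⟨x1, x2, x3, -⟩ := hx
  set n := (γ 0).2.2 with hndef
  set χ₀ := (γ 0).2.1 with hχ₀
  have hD := fun s hs => hasDerivWithinAt_components hγ (s := s) hs
  set γ' := derivWithin γ (Set.Icc 0 1) with hγ'
  have hone : ∀ s ∈ Set.Icc (0 : ℝ) 1, ‖(γ s).2.2‖ = 1 :=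
    fun s hs => norm_of_mem_compactification (h s hs).1
  set y : ℝ → ℝ := fun s => inner ℝ n (γ s).2.2 with hy
  have dy : ∀ s ∈ Set.Icc (0 : ℝ) 1,
      HasDerivWithinAt y (inner ℝ n (γ' s).2.2) (Set.Icc 0 1) s := by
    intro s hs
    have := (hasDerivWithinAt_const s (Set.Icc (0 : ℝ) 1) n).inner ℝ (hD s hs).2.2
    refine this.congr_deriv ?_
    simp
  -- The cosine of the spherical distance between the projections of `γ 0` and `γ s`.
  set f : ℝ → ℝ := fun s => Real.cos χ₀ * Real.cos (γ s).2.1 +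
    Real.sin χ₀ * Real.sin (γ s).2.1 * y s with hf
  have df : ∀ s ∈ Set.Icc (0 : ℝ) 1, HasDerivWithinAt f
      ((-Real.cos χ₀ * Real.sin (γ s).2.1 + Real.sin χ₀ * Real.cos (γ s).2.1 * y s) * (γ' s).2.1 +
        Real.sin χ₀ * Real.sin (γ s).2.1 * inner ℝ n (γ' s).2.2) (Set.Icc 0 1) s := by
    intro s hs
    have := (((hD s hs).2.1.cos.const_mul (Real.cos χ₀)).add
      (((hD s hs).2.1.sin.const_mul (Real.sin χ₀)).mul (dy s hs)))
    refine this.congr_deriv ?_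
    ring
  have key := cos_lt_of_slow df (fun s hs => (hD s hs).1) (fun s hs => (h s hs).2.1) ?_ ?_ ?_
  · have hy1 : y 1 = -1 := by
      simp only [hy, hax, inner_neg_right, real_inner_self_eq_norm_sq, hn]; norm_num
    simp only [hf, hy1] at key
    -- At an antipodal endpoint f = cos (χ₀ + χ₁), which is exactly the cosine of the elapsed T:
    -- this contradicts the strict inequality.
    have e : (γ 1).1 - (γ 0).1 = 2 * Real.pi - (χ₀ + (γ 1).2.1) := by linarith
    rw [e, Real.cos_two_pi_sub, Real.cos_add] at key
    linarith
  · intro s hs θ hθ0 hθπ hfθ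
    have hi := inner_derivWithin_eq_zero (uniqueDiffOn_Icc zero_lt_one s hs) hs (hD s hs).2.2 hone
    have hyy := inner_sq_le_of_orthogonal hn (hone s hs) hi
    have hy1 : 0 ≤ 1 - y s ^ 2 := by
      have := abs_le.1 (abs_real_inner_le_norm n (γ s).2.2)
      rw [hn, hone s hs, mul_one] at this
      nlinarith [this.1, this.2]
    have hb := sphere_speed_bound
      (A := -Real.cos χ₀ * Real.sin (γ s).2.1 + Real.sin χ₀ * Real.cos (γ s).2.1 * y s)
      (B := Real.sin χ₀) (X := (γ' s).2.1) (S := Real.sin (γ s).2.1) hyy hy1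
    -- The squared gradient of the cosine of the distance θ is sin² θ.
    have hid : (-Real.cos χ₀ * Real.sin (γ s).2.1 +
        Real.sin χ₀ * Real.cos (γ s).2.1 * y s) ^ 2 + Real.sin χ₀ ^ 2 * (1 - y s ^ 2) =
        Real.sin θ ^ 2 := by
      have e1 : Real.sin θ ^ 2 = 1 - f s ^ 2 := by rw [hfθ, Real.sin_sq]
      rw [e1]
      simp only [hf, mul_pow, add_sq, Real.sin_sq]
      ring
    rw [hid] at hb
    have hm := (h s hs).2.2
    have hT' := (h s hs).2.1
    simp only [confMetric, real_inner_self_eq_norm_sq] at hm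
    have hsin := Real.sin_pos_of_pos_of_lt_pi hθ0 hθπ
    -- Dropping the nonnegative throat term leaves the timelike condition of the Einstein static
    -- universe.
    have hlt : (γ' s).2.1 ^ 2 + Real.sin (γ s).2.1 ^ 2 * ‖(γ' s).2.2‖ ^ 2 < (γ' s).1 ^ 2 := by
      have : 0 ≤ a ^ 2 * (Real.cos (γ s).1 + Real.cos (γ s).2.1) ^ 2 * ‖(γ' s).2.2‖ ^ 2 := by
        positivity
      nlinarith
    have hfin := lt_of_le_of_lt hb (mul_lt_mul_of_pos_left hlt (pow_pos hsin 2))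
    rw [← mul_pow] at hfin
    exact (abs_lt_of_sq_lt_sq' hfin (by positivity)).1
  · simp only [hf, hy]
    change Real.cos χ₀ * Real.cos χ₀ + Real.sin χ₀ * Real.sin χ₀ * inner ℝ n n = 1
    rw [real_inner_self_eq_norm_sq, hn]
    nlinarith [Real.sin_sq_add_cos_sq χ₀]
  · linarith

/-! ### Causal curves and null generators on future null infinity -/

/-- Causality makes T + χ nondecreasing, and it already has its maximum π at x. The curve thus stays
in the null hypersurface T + χ = π, whose causal directions are those of the generators. -/
theorem eq_and_lt_of_isCausalCurve {d : ℕ} {a : ℝ} {γ : ℝ → Coord d} {x y : Coord d}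
    (hγ : IsCausalCurve a γ x y) (hx : x ∈ scriPlus₁ d) : x.2.2 = y.2.2 ∧ x.1 < y.1 := by
  obtain ⟨hγ, rfl, rfl, h⟩ := hγ
  have hD := fun s hs => hasDerivWithinAt_components hγ (s := s) hs
  set γ' := derivWithin γ (Set.Icc 0 1) with hγ'
  have z0 : (0 : ℝ) ∈ Set.Icc (0 : ℝ) 1 := by norm_num
  have z1 : (1 : ℝ) ∈ Set.Icc (0 : ℝ) 1 := by norm_num
  have hmono : StrictMonoOn (fun s => (γ s).1) (Set.Icc 0 1) := by
    apply strictMonoOn_of_hasDerivWithinAt_pos (convex_Icc 0 1)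
      (fun s hs => (hD s hs).1.continuousWithinAt) (f' := fun s => (γ' s).1)
    · intro s hs
      exact (hD s (interior_subset hs)).1.mono interior_subset
    · intro s hs
      exact (h s (interior_subset hs)).2.1
  have hnn : ∀ s ∈ Set.Icc (0 : ℝ) 1, 0 ≤ (γ' s).1 + (γ' s).2.1 := by
    intro s hs
    obtain ⟨-, h1, h2⟩ := h s hs
    simp only [confMetric, real_inner_self_eq_norm_sq] at h2
    have h3 : (γ' s).2.1 ^ 2 ≤ (γ' s).1 ^ 2 := by
      have : 0 ≤ (Real.sin (γ s).2.1 ^ 2 + a ^ 2 * (Real.cos (γ s).1 + Real.cos (γ s).2.1) ^ 2) *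
        ‖(γ' s).2.2‖ ^ 2 := by positivity
      nlinarith
    linarith [(abs_le_of_sq_le_sq' h3 h1.le).1]
  have hadd : ∀ s ∈ Set.Icc (0 : ℝ) 1, HasDerivWithinAt (fun s => (γ s).1 + (γ s).2.1)
      ((γ' s).1 + (γ' s).2.1) (Set.Icc 0 1) s := fun s hs => (hD s hs).1.add (hD s hs).2.1
  have hmono' : MonotoneOn (fun s => (γ s).1 + (γ s).2.1) (Set.Icc 0 1) := by
    apply monotoneOn_of_hasDerivWithinAt_nonneg (convex_Icc 0 1)
      (fun s hs => (hadd s hs).continuousWithinAt) (f' := fun s => (γ' s).1 + (γ' s).2.1)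
    · intro s hs
      exact (hadd s (interior_subset hs)).mono interior_subset
    · intro s hs
      exact hnn s (interior_subset hs)
  have hpi : ∀ s ∈ Set.Icc (0 : ℝ) 1, (γ s).1 + (γ s).2.1 = Real.pi := by
    intro s hs
    have h1 := hmono' z0 hs hs.1
    have h2 := add_le_pi_of_mem_compactification (h s hs).1
    have h3 := hx.2.2.1
    simp only at h1
    linarith
  have hzero : ∀ s ∈ Set.Icc (0 : ℝ) 1, (γ' s).2.2 = 0 := by
    intro s hs
    -- Now dT² = dχ², so causality leaves only a nonpositive multiple of the squared angular speed.
    -- Its coefficient is nonzero because sin χ > 0.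
    have h1 : (γ' s).1 + (γ' s).2.1 = 0 := by
      refine (uniqueDiffOn_Icc zero_lt_one s hs).eq_deriv _ (hadd s hs) ?_
      exact (hasDerivWithinAt_const s _ Real.pi).congr (fun r hr => hpi r hr) (hpi s hs)
    have hmem := mem_scriPlus₁_of_add_eq_pi (h s hs).1 (hpi s hs)
    have hsin := Real.sin_pos_of_pos_of_lt_pi hmem.2.1 (by linarith [hmem.1, hmem.2.2.1])
    have h2 := (h s hs).2.2
    simp only [confMetric, real_inner_self_eq_norm_sq] at h2
    have h3 : (γ' s).1 = -(γ' s).2.1 := by linarith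
    rw [h3] at h2
    have h4 : 0 < Real.sin (γ s).2.1 ^ 2 +
        a ^ 2 * (Real.cos (γ s).1 + Real.cos (γ s).2.1) ^ 2 := by positivity
    by_contra hne
    have h5 : 0 < ‖(γ' s).2.2‖ ^ 2 := by positivity
    nlinarith [mul_pos h4 h5]
  refine ⟨?_, hmono z0 z1 one_pos⟩
  have hconst := constant_of_derivWithin_zero (f := fun s => (γ s).2.2) (a := 0) (b := 1)
    (fun s hs => (hD s hs).2.2.differentiableWithinAt)
    (fun s hs => by
      have hs' := Set.Ico_subset_Icc_self hs
      rw [(hD s hs').2.2.derivWithin (uniqueDiffOn_Icc zero_lt_one s hs'), hzero s hs'])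
  exact (hconst 1 z1).symm

/-- Along a generator the angular velocity vanishes, so the variable coefficient drops out of the
Euler–Lagrange equations, and the linear parametrization is affine. -/
theorem nullGeodesicConnected_generator {d : ℕ} {a : ℝ} {x y : Coord d} (hx : x ∈ scriPlus₁ d)
    (hy : y ∈ scriPlus₁ d) (hax : x.2.2 = y.2.2) (hlt : x.1 < y.1) :
    NullGeodesicConnected a x y := by
  obtain ⟨T, χ, m⟩ := x
  obtain ⟨T', χ', m'⟩ := y
  obtain ⟨x1, x2, x3, hm⟩ := hx
  obtain ⟨y1, y2, y3, -⟩ := hy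
  simp only at x1 x2 x3 hm y1 y2 y3 hax hlt
  subst hax
  set Δ := T' - T with hΔ
  have hΔ0 : 0 < Δ := by linarith
  set γ : ℝ → Coord d := fun s => (T + s * Δ, χ - s * Δ, m) with hγ
  have hd : ∀ s ∈ Set.Icc (0 : ℝ) 1, derivWithin γ (Set.Icc 0 1) s = (Δ, -Δ, 0) := by
    intro s hs
    have h1 := ((hasDerivAt_id s).mul_const Δ)
    have := (h1.const_add T).prodMk ((h1.const_sub χ).prodMk (hasDerivAt_const s m))
    refine (this.hasDerivWithinAt.derivWithin (uniqueDiffOn_Icc zero_lt_one s hs)).trans ?_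
    simp
  refine ⟨γ, ⟨⟨?_, ?_⟩, ?_⟩, ?_, ?_, ?_⟩
  · exact ContDiff.contDiffOn (by fun_prop)
  · intro s hs
    refine ⟨hm, fun w hw => ?_⟩
    rw [derivWithin_congr (f := fun _ => Δ * w.1 + Δ * w.2.1)
      (fun r hr => by rw [hd r hr]; simp [confMetric])
      (by rw [hd s hs]; simp [confMetric]), hd s hs]
    simp [confMetric]
  · intro s hs
    rw [hd s hs]
    exact ⟨hΔ0, by simp [confMetric]⟩
  · intro s hs
    left; right; left
    refine ⟨?_, ?_, ?_, hm⟩ <;> simp only [hγ]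
    · nlinarith [hs.1]
    · nlinarith [hs.2, mul_nonneg (sub_nonneg.2 hs.2) hΔ0.le]
    · linarith
  · simp [hγ]
  · simp only [hγ]
    refine Prod.ext ?_ (Prod.ext ?_ rfl) <;> simp only <;> linarith

theorem isCausalCurve_of_nullGeodesicConnected {d : ℕ} {a : ℝ} {x y : Coord d}
    (h : NullGeodesicConnected a x y) : ∃ γ, IsCausalCurve a γ x y := by
  obtain ⟨γ, ⟨⟨h1, -⟩, h2⟩, h3, h4, h5⟩ := h
  exact ⟨γ, h1, h4, h5, fun s hs => ⟨h3 hs, (h2 s hs).1, (h2 s hs).2.ge⟩⟩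

/-! ### Quadratures for null rays: affine parameter, angle and time delay -/

theorem integral_neg_of_even {f : ℝ → ℝ} (hf : ∀ x, f (-x) = f x) (η : ℝ) :
    ∫ x in (0 : ℝ)..(-η), f x = -∫ x in (0 : ℝ)..η, f x := by
  have := intervalIntegral.integral_comp_neg (a := 0) (b := η) f
  simp only [hf, neg_zero] at this
  rw [this, intervalIntegral.integral_symm]

theorem le_of_hasDerivAt_le {f g f' g' : ℝ → ℝ} (hf : ∀ x, HasDerivAt f (f' x) x)
    (hg : ∀ x, HasDerivAt g (g' x) x) (h : ∀ x, f' x ≤ g' x) (h0 : f 0 = g 0) {x : ℝ}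
    (hx : 0 ≤ x) : f x ≤ g x := by
  have hm : Monotone fun x => g x - f x :=
    monotone_of_hasDerivAt_nonneg (fun x => (hg x).sub (hf x)) (fun x => sub_nonneg.2 (h x))
  have := hm hx
  simp only [h0] at this
  linarith

/-- For a = 0 the ray is a straight line and arctan (sinh η) is its angle. It is the bounded
comparison function for both integrals below. -/
theorem hasDerivAt_gudermannian (η : ℝ) :
    HasDerivAt (fun η => Real.arctan (Real.sinh η)) (1 / Real.cosh η) η := by
  refine (Real.hasDerivAt_sinh η).arctan.congr_deriv ?_
  rw [← Real.cosh_sq']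
  have := Real.cosh_pos η
  field_simp

theorem tendsto_sinh_atTop : Filter.Tendsto Real.sinh Filter.atTop Filter.atTop :=
  Filter.tendsto_atTop_mono' _
    (Filter.eventually_atTop.2 ⟨0, fun _ h => Real.self_le_sinh_iff.2 h⟩) Filter.tendsto_id

/-- `dσ/dη` along a null geodesic of unit energy and impact parameter `R`, parametrized by `η` with
`r = R cosh η`. -/
noncomputable def raySpeed (a R η : ℝ) : ℝ := √(R ^ 2 * Real.cosh η ^ 2 + a ^ 2)

/-- The affine parameter as a function of `η`. -/
noncomputable def rayParam (a R η : ℝ) : ℝ := ∫ x in (0 : ℝ)..η, raySpeed a R x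

/-- The inverse of `rayParam`. -/
noncomputable def rapidity (a R : ℝ) : ℝ → ℝ := Function.invFun (rayParam a R)

/-- The angle swept out since the point of closest approach. -/
noncomputable def rayAngle (a R η : ℝ) : ℝ :=
  ∫ x in (0 : ℝ)..η, √(R ^ 2 + a ^ 2) / raySpeed a R x

/-- The time delay of one half of the ray, compared with a ray in flat space. -/
noncomputable def rayDelay (a R : ℝ) : ℝ := ⨆ η, (rayParam a R η - R * Real.sinh η)

/-- The angle swept out by one half of the ray. -/
noncomputable def halfAngle (a R : ℝ) : ℝ := ⨆ η, rayAngle a R η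

section

variable {a R : ℝ}

theorem raySpeed_sq (a R η : ℝ) : raySpeed a R η ^ 2 = R ^ 2 * Real.cosh η ^ 2 + a ^ 2 :=
  Real.sq_sqrt (by positivity)

theorem mul_cosh_le_raySpeed (a R η : ℝ) : R * Real.cosh η ≤ raySpeed a R η :=
  Real.le_sqrt_of_sq_le (by nlinarith [sq_nonneg a])

theorem raySpeed_pos (hR : 0 < R) (η : ℝ) : 0 < raySpeed a R η :=
  (mul_pos hR (Real.cosh_pos η)).trans_le (mul_cosh_le_raySpeed a R η)

theorem raySpeed_neg (a R η : ℝ) : raySpeed a R (-η) = raySpeed a R η := by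
  simp [raySpeed]

theorem contDiff_raySpeed (hR : 0 < R) : ContDiff ℝ ∞ (raySpeed a R) := by
  have h : ContDiff ℝ ∞ fun η : ℝ => R ^ 2 * Real.cosh η ^ 2 + a ^ 2 :=
    (contDiff_const.mul (Real.contDiff_cosh.pow 2)).add contDiff_const
  exact h.sqrt fun η => by have := Real.cosh_pos η; positivity

theorem hasDerivAt_rayParam (hR : 0 < R) (η : ℝ) :
    HasDerivAt (rayParam a R) (raySpeed a R η) η :=
  ((contDiff_raySpeed hR).continuous.integral_hasStrictDerivAt 0 η).hasDerivAt

theorem hasDerivAt_rayAngle (hR : 0 < R) (η : ℝ) :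
    HasDerivAt (rayAngle a R) (√(R ^ 2 + a ^ 2) / raySpeed a R η) η :=
  ((continuous_const.div (contDiff_raySpeed hR).continuous
    fun η => (raySpeed_pos hR η).ne').integral_hasStrictDerivAt 0 η).hasDerivAt

theorem rayParam_zero (a R : ℝ) : rayParam a R 0 = 0 := by simp [rayParam]

theorem rayAngle_zero (a R : ℝ) : rayAngle a R 0 = 0 := by simp [rayAngle]

theorem rayParam_neg (a R η : ℝ) : rayParam a R (-η) = -rayParam a R η :=
  integral_neg_of_even (raySpeed_neg a R) η

theorem rayAngle_neg (a R η : ℝ) : rayAngle a R (-η) = -rayAngle a R η :=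
  integral_neg_of_even (fun x => by rw [raySpeed_neg]) η

theorem contDiff_of_hasDerivAt {f f' : ℝ → ℝ} (h : ∀ x, HasDerivAt f (f' x) x)
    (h' : ContDiff ℝ ∞ f') : ContDiff ℝ ∞ f := by
  rw [contDiff_infty_iff_deriv]
  refine ⟨fun x => (h x).differentiableAt, ?_⟩
  rwa [show deriv f = f' from funext fun x => (h x).deriv]

theorem contDiff_rayParam (hR : 0 < R) : ContDiff ℝ ∞ (rayParam a R) :=
  contDiff_of_hasDerivAt (hasDerivAt_rayParam hR) (contDiff_raySpeed hR)

theorem contDiff_rayAngle (hR : 0 < R) : ContDiff ℝ ∞ (rayAngle a R) :=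
  contDiff_of_hasDerivAt (hasDerivAt_rayAngle hR)
    (contDiff_const.div (contDiff_raySpeed hR) fun η => (raySpeed_pos hR η).ne')

theorem strictMono_rayParam (hR : 0 < R) : StrictMono (rayParam a R) :=
  strictMono_of_hasDerivAt_pos (hasDerivAt_rayParam hR) (raySpeed_pos hR)

theorem tendsto_rayParam_atTop (hR : 0 < R) :
    Filter.Tendsto (rayParam a R) Filter.atTop Filter.atTop := by
  refine Filter.tendsto_atTop_mono' _ (Filter.eventually_atTop.2 ⟨0, fun η h => ?_⟩)
    (Filter.tendsto_id.const_mul_atTop hR)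
  refine le_of_hasDerivAt_le (fun x => (hasDerivAt_id x).const_mul R) (hasDerivAt_rayParam hR)
    (fun x => ?_) (by simp [rayParam_zero]) h
  nlinarith [mul_cosh_le_raySpeed a R x, Real.one_le_cosh x]

theorem surjective_rayParam (hR : 0 < R) : Function.Surjective (rayParam a R) := by
  refine (contDiff_rayParam hR).continuous.surjective (tendsto_rayParam_atTop hR) ?_
  have := Filter.tendsto_neg_atTop_atBot.comp
    ((tendsto_rayParam_atTop (a := a) hR).comp Filter.tendsto_neg_atBot_atTop)
  refine this.congr fun η => ?_
  simp [rayParam_neg]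

theorem rayParam_rapidity (hR : 0 < R) (s : ℝ) : rayParam a R (rapidity a R s) = s :=
  Function.rightInverse_invFun (surjective_rayParam hR) s

theorem rapidity_rayParam (hR : 0 < R) (η : ℝ) : rapidity a R (rayParam a R η) = η :=
  Function.leftInverse_invFun (strictMono_rayParam hR).injective η

theorem contDiff_rapidity (hR : 0 < R) : ContDiff ℝ ∞ (rapidity a R) := by
  let F := (StrictMono.orderIsoOfSurjective (rayParam a R) (strictMono_rayParam hR)
    (surjective_rayParam hR)).toHomeomorph
  have h := F.contDiff_symm_deriv (n := ∞) (fun x => (raySpeed_pos (a := a) hR x).ne')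
    (hasDerivAt_rayParam hR) (contDiff_rayParam hR)
  have e : rapidity a R = F.symm := by
    funext s
    apply F.injective
    rw [F.apply_symm_apply]
    exact rayParam_rapidity hR s
  rwa [e]

theorem hasDerivAt_rapidity (hR : 0 < R) (s : ℝ) :
    HasDerivAt (rapidity a R) (1 / raySpeed a R (rapidity a R s)) s := by
  have h1 := (((contDiff_rapidity (a := a) hR).differentiable (by simp)) s).hasDerivAt
  have h2 := (hasDerivAt_rayParam (a := a) hR (rapidity a R s)).comp s h1
  have h3 : rayParam a R ∘ rapidity a R = id := funext (rayParam_rapidity hR)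
  rw [h3] at h2
  have h4 := h2.unique (hasDerivAt_id s)
  refine h1.congr_deriv ?_
  rw [eq_div_iff (raySpeed_pos hR _).ne']
  linarith

theorem tendsto_rapidity_atTop (hR : 0 < R) :
    Filter.Tendsto (rapidity a R) Filter.atTop Filter.atTop := by
  refine Filter.tendsto_atTop.2 fun b => ?_
  filter_upwards [Filter.eventually_ge_atTop (rayParam a R b)] with s hs
  rwa [← (strictMono_rayParam (a := a) hR).le_iff_le, rayParam_rapidity hR]

theorem tendsto_rapidity_atBot (hR : 0 < R) :
    Filter.Tendsto (rapidity a R) Filter.atBot Filter.atBot := by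
  refine Filter.tendsto_atBot.2 fun b => ?_
  filter_upwards [Filter.eventually_le_atBot (rayParam a R b)] with s hs
  rwa [← (strictMono_rayParam (a := a) hR).le_iff_le, rayParam_rapidity hR]

theorem hasDerivAt_excess (hR : 0 < R) (η : ℝ) :
    HasDerivAt (fun η => rayParam a R η - R * Real.sinh η)
      (raySpeed a R η - R * Real.cosh η) η :=
  (hasDerivAt_rayParam hR η).sub ((Real.hasDerivAt_sinh η).const_mul R)

theorem monotone_excess (hR : 0 < R) : Monotone fun η => rayParam a R η - R * Real.sinh η :=
  monotone_of_hasDerivAt_nonneg (hasDerivAt_excess hR)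
    fun η => sub_nonneg.2 (mul_cosh_le_raySpeed a R η)

theorem monotone_rayAngle (hR : 0 < R) : Monotone (rayAngle a R) :=
  monotone_of_hasDerivAt_nonneg (hasDerivAt_rayAngle hR)
    fun η => div_nonneg (Real.sqrt_nonneg _) (raySpeed_pos hR η).le

/-- With X = R cosh η one has √(X² + a²) - X ≤ a² / (2X), and the integral of 1 / cosh from 0 stays
below π/2. The factor 1 / R makes the delay vanish as R → ∞. -/
theorem excess_le (hR : 0 < R) (η : ℝ) :
    rayParam a R η - R * Real.sinh η ≤ a ^ 2 / (2 * R) * (Real.pi / 2) := by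
  have hc : 0 ≤ a ^ 2 / (2 * R) := by positivity
  rcases le_total 0 η with h | h
  · refine (le_of_hasDerivAt_le (hasDerivAt_excess hR)
      (fun x => (hasDerivAt_gudermannian x).const_mul (a ^ 2 / (2 * R))) (fun x => ?_)
      (by simp [rayParam_zero]) h).trans
      (mul_le_mul_of_nonneg_left (Real.arctan_lt_pi_div_two _).le hc)
    have h1 := mul_pos hR (Real.cosh_pos x)
    have h2 := mul_cosh_le_raySpeed a R x
    have h3 := raySpeed_sq a R x
    have h4 : a ^ 2 / (2 * R) * (1 / Real.cosh x) = a ^ 2 / (2 * (R * Real.cosh x)) := by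
      field_simp
    rw [h4, le_div_iff₀ (by positivity)]
    nlinarith
  · refine (monotone_excess hR h).trans ?_
    simp only [rayParam_zero, Real.sinh_zero]
    have := Real.pi_pos
    simp only [mul_zero, sub_zero]
    positivity

/-- The integrand is at most (R + |a|) / (R cosh η), since √(R² + a²) ≤ R + |a|. -/
theorem rayAngle_le (hR : 0 < R) (η : ℝ) :
    rayAngle a R η ≤ (1 + |a| / R) * (Real.pi / 2) := by
  have hc : 0 ≤ 1 + |a| / R := by positivity
  rcases le_total 0 η with h | h
  · refine (le_of_hasDerivAt_le (hasDerivAt_rayAngle hR)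
      (fun x => (hasDerivAt_gudermannian x).const_mul (1 + |a| / R)) (fun x => ?_)
      (by simp [rayAngle_zero]) h).trans
      (mul_le_mul_of_nonneg_left (Real.arctan_lt_pi_div_two _).le hc)
    have h2 := mul_cosh_le_raySpeed a R x
    have hch := Real.cosh_pos x
    have h1 := mul_pos hR hch
    have h4 : (1 + |a| / R) * (1 / Real.cosh x) = (R + |a|) / (R * Real.cosh x) := by
      field_simp
    rw [h4]
    refine div_le_div₀ (by positivity) ?_ h1 h2
    rw [Real.sqrt_le_left (by positivity)]
    nlinarith [sq_abs a, abs_nonneg a, mul_nonneg hR.le (abs_nonneg a)]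
  · refine (monotone_rayAngle hR h).trans ?_
    rw [rayAngle_zero]
    have := Real.pi_pos
    positivity

theorem tendsto_excess_atTop (hR : 0 < R) :
    Filter.Tendsto (fun η => rayParam a R η - R * Real.sinh η) Filter.atTop
      (nhds (rayDelay a R)) :=
  tendsto_atTop_ciSup (monotone_excess hR) ⟨_, Set.forall_mem_range.2 (excess_le hR)⟩

theorem tendsto_rayAngle_atTop (hR : 0 < R) :
    Filter.Tendsto (rayAngle a R) Filter.atTop (nhds (halfAngle a R)) :=
  tendsto_atTop_ciSup (monotone_rayAngle hR) ⟨_, Set.forall_mem_range.2 (rayAngle_le hR)⟩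

theorem tendsto_rayAngle_atBot (hR : 0 < R) :
    Filter.Tendsto (rayAngle a R) Filter.atBot (nhds (-halfAngle a R)) := by
  refine (((tendsto_rayAngle_atTop hR).comp Filter.tendsto_neg_atBot_atTop).neg).congr fun η => ?_
  simp [rayAngle_neg]

theorem rayDelay_nonneg (hR : 0 < R) : 0 ≤ rayDelay a R :=
  ge_of_tendsto (tendsto_excess_atTop hR) (Filter.eventually_atTop.2 ⟨0, fun η h => by
    simpa [rayParam_zero] using monotone_excess (a := a) hR h⟩)

theorem rayDelay_le (hR : 0 < R) : rayDelay a R ≤ a ^ 2 / (2 * R) * (Real.pi / 2) :=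
  le_of_tendsto (tendsto_excess_atTop hR) (Filter.Eventually.of_forall (excess_le hR))

theorem halfAngle_le (hR : 0 < R) : halfAngle a R ≤ (1 + |a| / R) * (Real.pi / 2) :=
  le_of_tendsto (tendsto_rayAngle_atTop hR) (Filter.Eventually.of_forall (rayAngle_le hR))

/-- Since R² cosh² η + a² ≤ (R² + a²) cosh² η, the integrand dominates its flat value 1 / cosh η. -/
theorem le_halfAngle (hR : 0 < R) : Real.pi / 2 ≤ halfAngle a R := by
  have h1 : Filter.Tendsto (fun η => Real.arctan (Real.sinh η)) Filter.atTop
      (nhds (Real.pi / 2)) :=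
    (Real.tendsto_arctan_atTop.mono_right nhdsWithin_le_nhds).comp tendsto_sinh_atTop
  refine le_of_tendsto_of_tendsto h1 (tendsto_rayAngle_atTop hR)
    (Filter.eventually_atTop.2 ⟨0, fun η h => ?_⟩)
  refine le_of_hasDerivAt_le hasDerivAt_gudermannian (hasDerivAt_rayAngle hR) (fun x => ?_)
    (by simp [rayAngle_zero]) h
  have hch := Real.cosh_pos x
  rw [div_le_div_iff₀ hch (raySpeed_pos hR x), one_mul]
  apply Real.sqrt_le_iff.2 ⟨by positivity, ?_⟩
  rw [mul_pow, Real.sq_sqrt (by positivity)]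
  nlinarith [Real.one_le_cosh x, sq_nonneg a, mul_nonneg (sq_nonneg a)
    (show 0 ≤ Real.cosh x ^ 2 - 1 by nlinarith [Real.one_le_cosh x])]

theorem tendsto_rayDelay (a : ℝ) :
    Filter.Tendsto (rayDelay a) Filter.atTop (nhds 0) := by
  have h : Filter.Tendsto (fun R : ℝ => a ^ 2 / (2 * R) * (Real.pi / 2)) Filter.atTop
      (nhds (0 * (Real.pi / 2))) :=
    ((Filter.tendsto_id.const_mul_atTop two_pos).const_div_atTop _).mul_const _
  rw [zero_mul] at h
  exact tendsto_of_tendsto_of_tendsto_of_le_of_le' tendsto_const_nhds h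
    ((Filter.eventually_gt_atTop 0).mono fun R hR => rayDelay_nonneg hR)
    ((Filter.eventually_gt_atTop 0).mono fun R hR => rayDelay_le hR)

theorem tendsto_halfAngle (a : ℝ) :
    Filter.Tendsto (halfAngle a) Filter.atTop (nhds (Real.pi / 2)) := by
  have h : Filter.Tendsto (fun R : ℝ => (1 + |a| / R) * (Real.pi / 2)) Filter.atTop
      (nhds ((1 + 0) * (Real.pi / 2))) :=
    ((Filter.tendsto_id.const_div_atTop _).const_add 1).mul_const _
  rw [add_zero, one_mul] at h
  exact tendsto_of_tendsto_of_tendsto_of_le_of_le' tendsto_const_nhds h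
    ((Filter.eventually_gt_atTop 0).mono fun R hR => le_halfAngle hR)
    ((Filter.eventually_gt_atTop 0).mono fun R hR => halfAngle_le hR)

end

/-! ### Integration of the geodesic equations in an equatorial plane -/

theorem eq_const_of_hasDerivAt_zero {f : ℝ → ℝ} (h : ∀ s, HasDerivAt f 0 s) (s s' : ℝ) :
    f s = f s' :=
  is_const_of_deriv_eq_zero (fun x => (h x).differentiableAt) (fun x => (h x).deriv) s s'

theorem hasDerivAt_zero_of_le {r : ℝ → ℝ} {r' s : ℝ} (h : HasDerivAt r r' s)
    (hmin : ∀ x, r s ≤ r x) : r' = 0 :=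
  IsLocalMin.hasDerivAt_eq_zero (Filter.Eventually.of_forall hmin) h

/-- The radial equation of a null geodesic determines `r` up to the affine parametrization. -/
theorem radius_eq_cosh_rapidity {a R E s₀ : ℝ} {r r' r'' : ℝ → ℝ} (hR : 0 < R) (hE : 0 < E)
    (dr : ∀ s, HasDerivAt r (r' s) s) (dr' : ∀ s, HasDerivAt r' (r'' s) s)
    (hs₀ : r s₀ = R) (hmin : ∀ s, R ≤ r s)
    (hen : ∀ s, r' s ^ 2 * (r s ^ 2 + a ^ 2) = E ^ 2 * (r s ^ 2 - R ^ 2))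
    (hacc : ∀ s, r'' s * (r s ^ 2 + a ^ 2) ^ 2 = r s * (E ^ 2 * (R ^ 2 + a ^ 2))) (s : ℝ) :
    r s = R * Real.cosh (rapidity a R (E * (s - s₀))) := by
  set q : ℝ → ℝ := fun s => √(r s ^ 2 + a ^ 2) with hq
  have hr : ∀ s, 0 < r s := fun s => hR.trans_le (hmin s)
  have hq2 : ∀ s, q s ^ 2 = r s ^ 2 + a ^ 2 := fun s => Real.sq_sqrt (by positivity)
  have hpos : ∀ s, 0 < r s ^ 2 + a ^ 2 := fun s => by have := hr s; positivity
  have hq0 : ∀ s, 0 < q s := fun s => Real.sqrt_pos.2 (hpos s)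
  -- This is sinh η along the ray. Recovering η from the velocity instead of from arcosh (r / R)
  -- keeps it smooth, with the right sign, through the point of closest approach.
  set g : ℝ → ℝ := fun s => r' s * q s / (E * R) with hg
  set η : ℝ → ℝ := fun s => Real.arsinh (g s) with hη
  have hg2 : ∀ s, 1 + g s ^ 2 = (r s / R) ^ 2 := by
    intro s
    have : g s ^ 2 = E ^ 2 * (r s ^ 2 - R ^ 2) / (E * R) ^ 2 := by
      simp only [hg, div_pow, mul_pow, hq2, hen]
    rw [this]; field_simp; ring
  have hch : ∀ s, Real.cosh (η s) = r s / R := by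
    intro s
    simp only [hη]
    rw [Real.cosh_arsinh, hg2, Real.sqrt_sq (div_pos (hr s) hR).le]
  have hsp : ∀ s, raySpeed a R (η s) = q s := by
    intro s
    rw [raySpeed, hch]
    simp only [hq]
    congr 1
    field_simp
  have dq : ∀ s, HasDerivAt q (r s * r' s / q s) s := by
    intro s
    refine ((((dr s).pow 2).add_const (a ^ 2)).sqrt (hpos s).ne').congr_deriv ?_
    simp only [hq, Pi.pow_apply]
    push_cast
    field_simp
  have dη : ∀ s, HasDerivAt η (E / q s) s := by
    intro s
    refine ((((dr' s).mul (dq s)).div_const (E * R)).arsinh).congr_deriv ?_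
    have h0 := hq0 s
    have h1 := hr s
    change (√(1 + g s ^ 2))⁻¹ • _ = _
    rw [hg2, Real.sqrt_sq (div_pos h1 hR).le, smul_eq_mul]
    have key : r'' s * q s ^ 2 + r s * r' s ^ 2 = r s * E ^ 2 := by
      have h2 := hen s
      have h3 := hacc s
      rw [← hq2] at h2 h3
      apply mul_right_cancel₀ (pow_pos h0 2).ne'
      linear_combination h3 + r s * h2 - r s * E ^ 2 * hq2 s
    field_simp
    linear_combination key
  -- Since η' = E / q and `rayParam` has derivative q at η, the parameter grows at the constant rate
  -- E.
  have dσ : ∀ s, HasDerivAt (fun s => rayParam a R (η s) - E * (s - s₀)) 0 s := by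
    intro s
    have h1 := ((hasDerivAt_rayParam (a := a) hR (η s)).comp s (dη s)).sub
      (((hasDerivAt_id s).sub_const s₀).const_mul E)
    refine h1.congr_deriv ?_
    rw [hsp]
    have := (hq0 s).ne'
    field_simp
    ring
  have hη0 : η s₀ = 0 := by
    have : r' s₀ = 0 := hasDerivAt_zero_of_le (dr s₀) (fun x => hs₀ ▸ hmin x)
    simp [hη, hg, this]
  have h := eq_const_of_hasDerivAt_zero dσ s s₀
  simp only [hη0, rayParam_zero, sub_self, mul_zero] at h
  rw [← sub_eq_zero.1 h, rapidity_rayParam hR, hch]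
  field_simp

theorem exists_angle_of_sq_add_sq {A B : ℝ} (h : A ^ 2 + B ^ 2 = 1) :
    ∃ φ, A = Real.cos φ ∧ B = Real.sin φ := by
  refine ⟨Complex.arg ⟨A, B⟩, ?_, ?_⟩
  · rw [Complex.cos_arg, Complex.norm_def, Complex.normSq_apply]
    · simp only [← sq, h, Real.sqrt_one, div_one]
    · intro h0
      have h1 := congrArg Complex.re h0
      have h2 := congrArg Complex.im h0
      simp only [Complex.zero_re, Complex.zero_im] at h1 h2
      rw [h1, h2] at h; norm_num at h
  · rw [sin_arg_mk, h, Real.sqrt_one, div_one]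

/-- A curve on the unit circle is determined by its angular velocity up to a rotation. -/
theorem exists_rotation {x y x' y' θ θ' : ℝ → ℝ} (dx : ∀ s, HasDerivAt x (x' s) s)
    (dy : ∀ s, HasDerivAt y (y' s) s) (dθ : ∀ s, HasDerivAt θ (θ' s) s)
    (hc : ∀ s, x s ^ 2 + y s ^ 2 = 1) (h : ∀ s, x s * y' s - y s * x' s = θ' s) :
    ∃ φ, ∀ s, x s = Real.cos (θ s + φ) ∧ y s = Real.sin (θ s + φ) := by
  have hor : ∀ s, x s * x' s + y s * y' s = 0 := by
    intro s
    have h1 := ((dx s).pow 2).add ((dy s).pow 2)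
    have h2 : HasDerivAt (x ^ 2 + y ^ 2) 0 s := by
      rw [show x ^ 2 + y ^ 2 = fun _ => (1 : ℝ) from funext hc]
      exact hasDerivAt_const s 1
    have := h1.unique h2
    norm_num at this
    linarith
  have hx' : ∀ s, x' s = -(y s * θ' s) := by
    intro s
    linear_combination (-x' s) * hc s + x s * hor s - y s * h s
  have hy' : ∀ s, y' s = x s * θ' s := by
    intro s
    linear_combination (-y' s) * hc s + y s * hor s + x s * h s
  -- Rotating (x, y) back by θ gives a constant unit vector, whose angle is φ.
  have dA : ∀ s, HasDerivAt (fun s => x s * Real.cos (θ s) + y s * Real.sin (θ s)) 0 s := by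
    intro s
    refine (((dx s).mul (dθ s).cos).add ((dy s).mul (dθ s).sin)).congr_deriv ?_
    rw [hx', hy']; ring
  have dB : ∀ s, HasDerivAt (fun s => y s * Real.cos (θ s) - x s * Real.sin (θ s)) 0 s := by
    intro s
    refine (((dy s).mul (dθ s).cos).sub ((dx s).mul (dθ s).sin)).congr_deriv ?_
    rw [hx', hy']; ring
  have hn : (x 0 * Real.cos (θ 0) + y 0 * Real.sin (θ 0)) ^ 2 +
      (y 0 * Real.cos (θ 0) - x 0 * Real.sin (θ 0)) ^ 2 = 1 := by
    linear_combination (Real.sin (θ 0) ^ 2 + Real.cos (θ 0) ^ 2) * hc 0 +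
      Real.sin_sq_add_cos_sq (θ 0)
  obtain ⟨φ, h1, h2⟩ := exists_angle_of_sq_add_sq hn
  refine ⟨φ, fun s => ?_⟩
  have e1 := eq_const_of_hasDerivAt_zero dA s 0
  have e2 := eq_const_of_hasDerivAt_zero dB s 0
  simp only [h1, h2] at e1 e2
  rw [Real.cos_add, Real.sin_add, ← e1, ← e2]
  have := Real.sin_sq_add_cos_sq (θ s)
  constructor
  · linear_combination (-x s) * this
  · linear_combination (-y s) * this

/-- Classification of the null geodesics of positive impact parameter in an equatorial plane with
Cartesian coordinates `x`, `y` on the sphere. -/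
theorem ray_classification {a R E s₀ : ℝ} {r r' r'' x x' x'' y y' y'' : ℝ → ℝ} (hR : 0 < R)
    (hE : 0 < E)
    (dr : ∀ s, HasDerivAt r (r' s) s) (dr' : ∀ s, HasDerivAt r' (r'' s) s)
    (dx : ∀ s, HasDerivAt x (x' s) s) (dx' : ∀ s, HasDerivAt x' (x'' s) s)
    (dy : ∀ s, HasDerivAt y (y' s) s) (dy' : ∀ s, HasDerivAt y' (y'' s) s)
    (hs₀ : r s₀ = R) (hmin : ∀ s, R ≤ r s) (hc : ∀ s, x s ^ 2 + y s ^ 2 = 1)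
    (hacc : ∀ s, r'' s = r s * (x' s ^ 2 + y' s ^ 2))
    (hnull : ∀ s, E ^ 2 = r' s ^ 2 + (r s ^ 2 + a ^ 2) * (x' s ^ 2 + y' s ^ 2))
    (hang : ∀ s, 2 * r s * r' s * (x s * y' s - y s * x' s) +
      (r s ^ 2 + a ^ 2) * (x s * y'' s - y s * x'' s) = 0) :
    ∃ ε : ℝ, (ε = 1 ∨ ε = -1) ∧ ∃ φ, ∀ s, r s = R * Real.cosh (rapidity a R (E * (s - s₀))) ∧
      x s = Real.cos (ε * rayAngle a R (rapidity a R (E * (s - s₀))) + φ) ∧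
      y s = Real.sin (ε * rayAngle a R (rapidity a R (E * (s - s₀))) + φ) := by
  have hr : ∀ s, 0 < r s := fun s => hR.trans_le (hmin s)
  have hpos : ∀ s, 0 < r s ^ 2 + a ^ 2 := fun s => by have := hr s; positivity
  set w : ℝ → ℝ := fun s => x s * y' s - y s * x' s with hw
  have hor : ∀ s, x s * x' s + y s * y' s = 0 := by
    intro s
    have h1 := ((dx s).pow 2).add ((dy s).pow 2)
    have h2 : HasDerivAt (x ^ 2 + y ^ 2) 0 s := by
      rw [show x ^ 2 + y ^ 2 = fun _ => (1 : ℝ) from funext hc]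
      exact hasDerivAt_const s 1
    have := h1.unique h2
    norm_num at this
    linarith
  have hw2 : ∀ s, x' s ^ 2 + y' s ^ 2 = w s ^ 2 := by
    intro s
    simp only [hw]
    linear_combination (-(x' s ^ 2 + y' s ^ 2)) * hc s + (x s * x' s + y s * y' s) * hor s
  -- Conservation of angular momentum.
  have dL : ∀ s, HasDerivAt (fun s => (r s ^ 2 + a ^ 2) * w s) 0 s := by
    intro s
    refine ((((dr s).pow 2).add_const (a ^ 2)).mul
      (((dx s).mul (dy' s)).sub ((dy s).mul (dx' s)))).congr_deriv ?_
    simp only [Pi.mul_apply, Pi.sub_apply, Pi.pow_apply]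
    linear_combination hang s
  set b := √(R ^ 2 + a ^ 2) with hb
  have hb2 : b ^ 2 = R ^ 2 + a ^ 2 := Real.sq_sqrt (by positivity)
  have hr0 : r' s₀ = 0 := hasDerivAt_zero_of_le (dr s₀) (fun x => hs₀ ▸ hmin x)
  -- At closest approach r' = 0, so the null condition fixes the angular momentum up to the sense of
  -- rotation.
  have hL : ∃ ε : ℝ, (ε = 1 ∨ ε = -1) ∧ ∀ s, (r s ^ 2 + a ^ 2) * w s = ε * E * b := by
    have h1 : ((r s₀ ^ 2 + a ^ 2) * w s₀) ^ 2 = (E * b) ^ 2 := by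
      have := hnull s₀
      rw [hw2, hr0] at this
      rw [mul_pow E, hb2, this, hs₀]; ring
    rcases sq_eq_sq_iff_eq_or_eq_neg.1 h1 with h | h
    · exact ⟨1, Or.inl rfl, fun s => by rw [eq_const_of_hasDerivAt_zero dL s s₀, h]; ring⟩
    · exact ⟨-1, Or.inr rfl, fun s => by rw [eq_const_of_hasDerivAt_zero dL s s₀, h]; ring⟩
  obtain ⟨ε, hε, hL⟩ := hL
  have hε2 : ε ^ 2 = 1 := by rcases hε with rfl | rfl <;> norm_num
  have hLs : ∀ s, (r s ^ 2 + a ^ 2) ^ 2 * w s ^ 2 = E ^ 2 * (R ^ 2 + a ^ 2) := by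
    intro s
    rw [← mul_pow, hL, mul_pow, mul_pow, hε2, hb2]; ring
  have hrad := radius_eq_cosh_rapidity hR hE dr dr' hs₀ hmin
    (a := a) (fun s => by
      have h1 := hnull s
      rw [hw2] at h1
      linear_combination (-(r s ^ 2 + a ^ 2)) * h1 - hLs s)
    (fun s => by rw [hacc, hw2, ← hLs s]; ring)
  set η : ℝ → ℝ := fun s => rapidity a R (E * (s - s₀)) with hη
  have hsp : ∀ s, raySpeed a R (η s) ^ 2 = r s ^ 2 + a ^ 2 := by
    intro s
    rw [raySpeed_sq, hrad s, mul_pow]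
  have dθ : ∀ s, HasDerivAt (fun s => ε * rayAngle a R (η s)) (w s) s := by
    intro s
    have h1 := (((hasDerivAt_id s).sub_const s₀).const_mul E)
    have h2 := (hasDerivAt_rapidity (a := a) hR _).comp s h1
    have h3 := ((hasDerivAt_rayAngle (a := a) hR _).comp s h2).const_mul ε
    refine h3.congr_deriv ?_
    have h4 := raySpeed_pos (a := a) hR (η s)
    have h5 := hL s
    rw [← hsp] at h5
    change ε * (b / raySpeed a R (η s) * (1 / raySpeed a R (η s) * (E * 1))) = w s
    field_simp
    linarith
  obtain ⟨φ, hφ⟩ := exists_rotation dx dy dθ hc (fun s => rfl)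
  exact ⟨ε, hε, φ, fun s => ⟨hrad s, hφ s⟩⟩

/-! ### Rays from a given point of past null infinity and their endpoints -/

section

variable {d : ℕ}

theorem derivWithin_physMetric_left {a : ℝ} {t t' t'' r r' r'' : ℝ → ℝ}
    {o o' o'' : ℝ → EuclideanSpace ℝ (Fin d)}
    (dt : ∀ s, HasDerivAt t (t' s) s) (dt' : ∀ s, HasDerivAt t' (t'' s) s)
    (dr : ∀ s, HasDerivAt r (r' s) s) (dr' : ∀ s, HasDerivAt r' (r'' s) s)
    (dom : ∀ s, HasDerivAt o (o' s) s) (dom' : ∀ s, HasDerivAt o' (o'' s) s) (s : ℝ)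
    (w : Coord d) :
    derivWithin (fun σ => physMetric a (t σ, r σ, o σ)
      (derivWithin (fun σ => ((t σ, r σ, o σ) : Coord d)) Set.univ σ) w) Set.univ s =
      t'' s * w.1 - r'' s * w.2.1 - (2 * r s * r' s * inner ℝ (o' s) w.2.2 +
        (r s ^ 2 + a ^ 2) * inner ℝ (o'' s) w.2.2) := by
  have h1 : ∀ σ, derivWithin (fun σ => ((t σ, r σ, o σ) : Coord d)) Set.univ σ =
      (t' σ, r' σ, o' σ) := fun σ => by
    rw [derivWithin_univ]
    exact ((dt σ).prodMk ((dr σ).prodMk (dom σ))).deriv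
  simp only [h1, physMetric, derivWithin_univ]
  have h2 := (dom' s).inner ℝ (hasDerivAt_const s w.2.2)
  have h3 := (((dt' s).mul_const w.1).sub ((dr' s).mul_const w.2.1)).sub
    ((((dr s).pow 2).add_const (a ^ 2)).mul h2)
  refine h3.deriv.trans ?_
  simp

theorem deriv_physMetric_base (a : ℝ) (x v w : Coord d) :
    deriv (fun ε : ℝ => physMetric a (x + ε • w) v v) 0 =
      -(2 * x.2.1 * w.2.1 * inner ℝ v.2.2 v.2.2) := by
  have h1 : HasDerivAt (fun ε : ℝ => x.2.1 + ε * w.2.1) (1 * w.2.1) 0 :=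
    ((hasDerivAt_id (0 : ℝ)).mul_const w.2.1).const_add x.2.1
  have h2 := (((h1.pow 2).add_const (a ^ 2)).mul_const (inner ℝ v.2.2 v.2.2)).const_sub
    (v.1 * v.1 - v.2.1 * v.2.1)
  refine h2.deriv.trans ?_
  simp

theorem eq_inner_add_inner {P : Submodule ℝ (EuclideanSpace ℝ (Fin d))}
    (hP : Module.finrank ℝ P = 2) {n e m : EuclideanSpace ℝ (Fin d)} (hn : ‖n‖ = 1)
    (he : ‖e‖ = 1) (hne : inner ℝ n e = 0) (hnP : n ∈ P) (heP : e ∈ P) (hm : m ∈ P) :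
    m = (inner ℝ n m : ℝ) • n + (inner ℝ e m : ℝ) • e := by
  have hen : (inner ℝ e n : ℝ) = 0 := by rw [real_inner_comm]; exact hne
  have hnn : (inner ℝ n n : ℝ) = 1 := by rw [real_inner_self_eq_norm_sq, hn, one_pow]
  have hee : (inner ℝ e e : ℝ) = 1 := by rw [real_inner_self_eq_norm_sq, he, one_pow]
  have hli : LinearIndependent ℝ ![n, e] := by
    rw [LinearIndependent.pair_iff]
    intro x y h
    have h1 := congrArg (fun z => (inner ℝ n z : ℝ)) h
    have h2 := congrArg (fun z => (inner ℝ e z : ℝ)) h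
    simp only [inner_add_right, inner_smul_right, hne, hen, hnn, hee, inner_zero_right] at h1 h2
    exact ⟨by linarith, by linarith⟩
  have hle : Submodule.span ℝ {n, e} ≤ P := by
    rw [Submodule.span_le]
    rintro x (rfl | rfl)
    exacts [hnP, heP]
  have hrank : Module.finrank ℝ (Submodule.span ℝ {n, e}) = 2 := by
    have := finrank_span_eq_card hli
    rwa [Matrix.range_cons_cons_empty, Fintype.card_fin] at this
  have hspan := Submodule.eq_of_le_of_finrank_eq hle (hrank.trans hP.symm)
  rw [← hspan] at hm
  obtain ⟨x, y, rfl⟩ := Submodule.mem_span_pair.1 hm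
  simp only [inner_add_right, inner_smul_right, hne, hen, hnn, hee, mul_one, mul_zero, add_zero,
    zero_add]

/-- The null geodesic with impact parameter `R`, advanced time `v` at past infinity and past
direction `n`, in the plane of `n` and `e`; `ε = ±1` is its sense of rotation. -/
noncomputable def stdRay (a R v : ℝ) (n e : EuclideanSpace ℝ (Fin d)) (ε σ : ℝ) : Coord d :=
  (v + rayDelay a R + σ, R * Real.cosh (rapidity a R σ),
    Real.cos (ε * (rayAngle a R (rapidity a R σ) + halfAngle a R)) • n +
      Real.sin (ε * (rayAngle a R (rapidity a R σ) + halfAngle a R)) • e)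

/-- The future endpoint of `stdRay`, in terms of the delay and the half angle. -/
noncomputable def rayEnd (v : ℝ) (n e : EuclideanSpace ℝ (Fin d)) (ε D A : ℝ) : Coord d :=
  (Real.pi / 2 + Real.arctan (v + 2 * D), Real.pi / 2 - Real.arctan (v + 2 * D),
    Real.cos (ε * (2 * A)) • n + Real.sin (ε * (2 * A)) • e)

variable {a R v ε : ℝ} {n e : EuclideanSpace ℝ (Fin d)}

open Filter Topology

theorem tendsto_cosh_rapidity_atTop (hR : 0 < R) :
    Tendsto (fun σ => R * Real.cosh (rapidity a R σ)) atTop atTop := by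
  refine Tendsto.const_mul_atTop hR ?_
  refine tendsto_atTop_mono (fun σ => ?_) (tendsto_sinh_atTop.comp (tendsto_rapidity_atTop (a := a) hR))
  exact (Real.sinh_lt_cosh _).le

theorem rapidity_neg (hR : 0 < R) (σ : ℝ) : rapidity a R (-σ) = -rapidity a R σ := by
  apply (strictMono_rayParam (a := a) hR).injective
  rw [rayParam_rapidity hR, rayParam_neg, rayParam_rapidity hR]

theorem tendsto_cosh_rapidity_atBot (hR : 0 < R) :
    Tendsto (fun σ => R * Real.cosh (rapidity a R σ)) atBot atTop :=
  ((tendsto_cosh_rapidity_atTop (a := a) hR).comp tendsto_neg_atBot_atTop).congr fun σ => by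
    simp [rapidity_neg (a := a) hR]

/-- The delay is defined with R sinh η instead of r = R cosh η; the two differ by R exp (-η), which
tends to 0. -/
theorem tendsto_sub_radius_atTop (hR : 0 < R) :
    Tendsto (fun σ => σ - R * Real.cosh (rapidity a R σ)) atTop (𝓝 (rayDelay a R)) := by
  have h1 := (tendsto_excess_atTop (a := a) hR).comp (tendsto_rapidity_atTop (a := a) hR)
  have h2 := (Real.tendsto_exp_neg_atTop_nhds_zero.comp
    (tendsto_rapidity_atTop (a := a) hR)).const_mul R
  have h3 := h1.sub h2
  rw [mul_zero, sub_zero] at h3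
  refine h3.congr fun σ => ?_
  simp only [Function.comp, rayParam_rapidity hR, ← Real.cosh_sub_sinh]
  ring

theorem tendsto_add_radius_atBot (hR : 0 < R) :
    Tendsto (fun σ => σ + R * Real.cosh (rapidity a R σ)) atBot (𝓝 (-rayDelay a R)) :=
  (((tendsto_sub_radius_atTop (a := a) hR).comp tendsto_neg_atBot_atTop).neg).congr fun σ => by
    simp only [Function.comp, rapidity_neg (a := a) hR, Real.cosh_neg]; ring

theorem tendsto_stdRay_atBot (hR : 0 < R) :
    Tendsto (fun σ => compactify (stdRay a R v n e ε σ)) atBot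
      (𝓝 (Real.arctan v - Real.pi / 2, Real.arctan v + Real.pi / 2, n)) := by
  have h1 : Tendsto (fun σ => (stdRay a R v n e ε σ).1 + (stdRay a R v n e ε σ).2.1) atBot
      (𝓝 v) := by
    have := (tendsto_add_radius_atBot (a := a) hR).const_add (v + rayDelay a R)
    rw [add_neg_cancel_right] at this
    exact this.congr fun σ => by simp only [stdRay]; ring
  have h2 : Tendsto (fun σ => (stdRay a R v n e ε σ).1 - (stdRay a R v n e ε σ).2.1) atBot
      atBot := by
    have := h1.add_atBot (tendsto_neg_atTop_atBot.comp
      ((tendsto_cosh_rapidity_atBot (a := a) hR).const_mul_atTop two_pos))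
    exact this.congr fun σ => by simp only [stdRay, Function.comp]; ring
  have k1 := (Real.continuous_arctan.tendsto v).comp h1
  have k2 := (Real.tendsto_arctan_atBot.mono_right nhdsWithin_le_nhds).comp h2
  have h3 := ((tendsto_rayAngle_atBot (a := a) hR).comp
    (tendsto_rapidity_atBot (a := a) hR)).add_const (halfAngle a R)
  rw [neg_add_cancel] at h3
  have h4 : Continuous fun θ : ℝ => Real.cos (ε * θ) • n + Real.sin (ε * θ) • e := by fun_prop
  have k3 := (h4.tendsto 0).comp h3
  simp only [mul_zero, Real.cos_zero, Real.sin_zero, one_smul, zero_smul, add_zero] at k3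
  have := (k1.add k2).prodMk_nhds ((k1.sub k2).prodMk_nhds k3)
  rw [← sub_eq_add_neg, sub_neg_eq_add] at this
  exact this

theorem tendsto_stdRay_atTop (hR : 0 < R) :
    Tendsto (fun σ => compactify (stdRay a R v n e ε σ)) atTop
      (𝓝 (rayEnd v n e ε (rayDelay a R) (halfAngle a R))) := by
  have h1 : Tendsto (fun σ => (stdRay a R v n e ε σ).1 - (stdRay a R v n e ε σ).2.1) atTop
      (𝓝 (v + 2 * rayDelay a R)) := by
    have := (tendsto_sub_radius_atTop (a := a) hR).const_add (v + rayDelay a R)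
    rw [add_assoc, ← two_mul] at this
    exact this.congr fun σ => by simp only [stdRay]; ring
  have h2 : Tendsto (fun σ => (stdRay a R v n e ε σ).1 + (stdRay a R v n e ε σ).2.1) atTop
      atTop := by
    have := h1.add_atTop ((tendsto_cosh_rapidity_atTop (a := a) hR).const_mul_atTop two_pos)
    exact this.congr fun σ => by simp only [stdRay]; ring
  have k1 := (Real.continuous_arctan.tendsto _).comp h1
  have k2 := (Real.tendsto_arctan_atTop.mono_right nhdsWithin_le_nhds).comp h2
  have h3 := ((tendsto_rayAngle_atTop (a := a) hR).comp
    (tendsto_rapidity_atTop (a := a) hR)).add_const (halfAngle a R)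
  rw [← two_mul] at h3
  have h4 : Continuous fun θ : ℝ => Real.cos (ε * θ) • n + Real.sin (ε * θ) • e := by fun_prop
  have k3 := (h4.tendsto _).comp h3
  exact (k2.add k1).prodMk_nhds ((k2.sub k1).prodMk_nhds k3)

theorem hasDerivAt_raySpeed (hR : 0 < R) (η : ℝ) : HasDerivAt (raySpeed a R)
    (R ^ 2 * Real.cosh η * Real.sinh η / raySpeed a R η) η := by
  have hpos : 0 < R ^ 2 * Real.cosh η ^ 2 + a ^ 2 := by
    have := Real.cosh_pos η; positivity
  refine (((((Real.hasDerivAt_cosh η).pow 2).const_mul (R ^ 2)).add_const (a ^ 2)).sqrt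
    hpos.ne').congr_deriv ?_
  simp only [raySpeed, Pi.pow_apply]
  push_cast
  field_simp

theorem isEquatorialRay_stdRay {P : Submodule ℝ (EuclideanSpace ℝ (Fin d))} (hR : 0 < R)
    (hn : ‖n‖ = 1) (he : ‖e‖ = 1) (hne : inner ℝ n e = 0) (hnP : n ∈ P) (heP : e ∈ P)
    (hε : ε ^ 2 = 1) :
    IsEquatorialRay a P (Real.arctan v - Real.pi / 2, Real.arctan v + Real.pi / 2, n) R
      (stdRay a R v n e ε) := by
  set η := rapidity a R with hη
  set S : ℝ → ℝ := fun σ => raySpeed a R (η σ) with hS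
  set b := √(R ^ 2 + a ^ 2) with hb
  have hb2 : b ^ 2 = R ^ 2 + a ^ 2 := Real.sq_sqrt (by positivity)
  have hS0 : ∀ σ, S σ ≠ 0 := fun σ => (raySpeed_pos hR _).ne'
  have hS2 : ∀ σ, S σ ^ 2 = R ^ 2 * Real.cosh (η σ) ^ 2 + a ^ 2 := fun σ => raySpeed_sq a R _
  have dη : ∀ σ, HasDerivAt η (1 / S σ) σ := hasDerivAt_rapidity hR
  have dS : ∀ σ, HasDerivAt S (R ^ 2 * Real.cosh (η σ) * Real.sinh (η σ) / S σ ^ 2) σ := by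
    intro σ
    refine ((hasDerivAt_raySpeed (a := a) hR (η σ)).comp σ (dη σ)).congr_deriv ?_
    change _ / S σ * (1 / S σ) = _
    have := hS0 σ
    field_simp
  set r : ℝ → ℝ := fun σ => R * Real.cosh (η σ) with hr
  have dr : ∀ σ, HasDerivAt r (R * Real.sinh (η σ) / S σ) σ := by
    intro σ
    refine ((dη σ).cosh.const_mul R).congr_deriv ?_
    ring
  have dr' : ∀ σ, HasDerivAt (fun σ => R * Real.sinh (η σ) / S σ) (r σ * b ^ 2 / S σ ^ 4) σ := by
    intro σ
    refine ((((dη σ).sinh).const_mul R).div (dS σ) (hS0 σ)).congr_deriv ?_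
    have h0 := hS0 σ
    -- As S² = r² + a², this identity says that radial and angular motion add up to unit energy.
    have h1 : b ^ 2 = S σ ^ 2 - R ^ 2 * Real.sinh (η σ) ^ 2 := by
      rw [hb2, hS2, Real.cosh_sq]; ring
    rw [h1]
    simp only [hr]
    field_simp
  set θ : ℝ → ℝ := fun σ => ε * (rayAngle a R (η σ) + halfAngle a R) with hθ
  have dθ : ∀ σ, HasDerivAt θ (ε * b / S σ ^ 2) σ := by
    intro σ
    refine ((((hasDerivAt_rayAngle (a := a) hR (η σ)).comp σ (dη σ)).add_const
      (halfAngle a R)).const_mul ε).congr_deriv ?_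
    change ε * (b / S σ * (1 / S σ)) = _
    have := hS0 σ
    field_simp
  have dθ' : ∀ σ, HasDerivAt (fun σ => ε * b / S σ ^ 2)
      (-(2 * ε * b * (R ^ 2 * Real.cosh (η σ) * Real.sinh (η σ))) / S σ ^ 5) σ := by
    intro σ
    refine ((hasDerivAt_const σ (ε * b)).div ((dS σ).pow 2) (pow_ne_zero 2 (hS0 σ))).congr_deriv ?_
    have := hS0 σ
    simp only [Pi.pow_apply]
    push_cast
    field_simp
    ring
  set o : ℝ → EuclideanSpace ℝ (Fin d) := fun σ => Real.cos (θ σ) • n + Real.sin (θ σ) • e with ho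
  set J : ℝ → EuclideanSpace ℝ (Fin d) := fun σ => -Real.sin (θ σ) • n + Real.cos (θ σ) • e with hJ
  have hon : ∀ σ, ‖o σ‖ = 1 := fun σ => norm_cos_add_sin hn he hne _
  have hJn : ∀ σ, ‖J σ‖ = 1 := fun σ => by
    have := norm_cos_add_sin hn he hne (θ σ + Real.pi / 2)
    rwa [Real.cos_add_pi_div_two, Real.sin_add_pi_div_two] at this
  have dom : ∀ σ, HasDerivAt o ((ε * b / S σ ^ 2) • J σ) σ := by
    intro σ
    refine (((dθ σ).cos.smul_const n).add ((dθ σ).sin.smul_const e)).congr_deriv ?_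
    simp only [hJ]
    module
  have dJ : ∀ σ, HasDerivAt J (-(ε * b / S σ ^ 2) • o σ) σ := by
    intro σ
    refine (((dθ σ).sin.neg.smul_const n).add ((dθ σ).cos.smul_const e)).congr_deriv ?_
    simp only [ho]
    module
  have dom' : ∀ σ, HasDerivAt (fun σ => (ε * b / S σ ^ 2) • J σ)
      ((ε * b / S σ ^ 2) • (-(ε * b / S σ ^ 2) • o σ) +
        (-(2 * ε * b * (R ^ 2 * Real.cosh (η σ) * Real.sinh (η σ))) / S σ ^ 5) • J σ) σ :=
    fun σ => (dθ' σ).smul (dJ σ)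
  have dt : ∀ σ, HasDerivAt (fun σ => v + rayDelay a R + σ) 1 σ :=
    fun σ => (hasDerivAt_id σ).const_add _
  have hγ : stdRay a R v n e ε = fun σ => (v + rayDelay a R + σ, r σ, o σ) := rfl
  have hγ' : ∀ σ, derivWithin (stdRay a R v n e ε) Set.univ σ =
      (1, R * Real.sinh (η σ) / S σ, (ε * b / S σ ^ 2) • J σ) := fun σ => by
    rw [hγ, derivWithin_univ]
    exact ((dt σ).prodMk ((dr σ).prodMk (dom σ))).deriv
  have hJJ : ∀ σ, (inner ℝ ((ε * b / S σ ^ 2) • J σ) ((ε * b / S σ ^ 2) • J σ) : ℝ) =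
      b ^ 2 / S σ ^ 4 := fun σ => by
    rw [real_inner_self_eq_norm_sq, norm_smul, hJn, mul_one, Real.norm_eq_abs, sq_abs, div_pow,
      mul_pow, hε, one_mul]
    ring
  refine ⟨⟨⟨?_, fun s _ => ⟨hon s, fun w hw => ?_⟩⟩, fun s _ => ?_⟩, fun s => ?_,
    tendsto_stdRay_atBot hR, ?_⟩
  · rw [contDiffOn_univ, hγ]
    have sη : ContDiff ℝ ∞ η := contDiff_rapidity hR
    have sθ : ContDiff ℝ ∞ θ :=
      contDiff_const.mul (((contDiff_rayAngle (a := a) hR).comp sη).add contDiff_const)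
    have sr : ContDiff ℝ ∞ r := contDiff_const.mul (Real.contDiff_cosh.comp sη)
    have som : ContDiff ℝ ∞ o := by fun_prop
    exact (by fun_prop : ContDiff ℝ ∞ fun σ => v + rayDelay a R + σ).prodMk (sr.prodMk som)
  · have h1 := derivWithin_physMetric_left (a := a) dt (fun σ => hasDerivAt_const σ (1 : ℝ))
      dr dr' dom dom' s w
    rw [hγ' s, deriv_physMetric_base]
    refine h1.trans ?_
    change inner ℝ (o s) w.2.2 = (0 : ℝ) at hw
    simp only [hJJ, inner_add_left, inner_smul_left, hw]
    have hrS : r s ^ 2 + a ^ 2 = S s ^ 2 := by rw [hS2]; simp only [hr]; ring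
    rw [hrS]
    change _ = 1 / 2 * -(2 * r s * w.2.1 * (b ^ 2 / S s ^ 4))
    simp only [hr, conj_trivial]
    have := hS0 s
    field_simp
    ring
  · rw [hγ' s]
    refine ⟨one_pos, ?_⟩
    simp only [physMetric, hJJ]
    have hrS : (stdRay a R v n e ε s).2.1 ^ 2 + a ^ 2 = S s ^ 2 := by
      rw [hS2]; simp only [hγ, hr]; ring
    have h1 : b ^ 2 = S s ^ 2 - R ^ 2 * Real.sinh (η s) ^ 2 := by
      rw [hb2, hS2, Real.cosh_sq]; ring
    rw [hrS, h1]
    have := hS0 s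
    field_simp
    ring
  · exact P.add_mem (P.smul_mem _ hnP) (P.smul_mem _ heP)
  · constructor
    · refine ⟨0, ?_⟩
      have : rapidity a R 0 = 0 := by
        have := rapidity_rayParam (a := a) hR 0
        rwa [rayParam_zero] at this
      simp [stdRay, this]
    · rintro _ ⟨s, rfl⟩
      change R ≤ R * Real.cosh (η s)
      nlinarith [Real.one_le_cosh (η s)]

/-- The geodesic equations leave free the energy, the parameter of closest approach, the sense of
rotation, a time shift and a phase. The past endpoint fixes the last two. -/
theorem exists_eq_stdRay {P : Submodule ℝ (EuclideanSpace ℝ (Fin d))}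
    (hP : Module.finrank ℝ P = 2) (hR : 0 < R)
    (hn : ‖n‖ = 1) (he : ‖e‖ = 1) (hne : inner ℝ n e = 0) (hnP : n ∈ P) (heP : e ∈ P)
    {γ : ℝ → Coord d}
    (hγ : IsEquatorialRay a P (Real.arctan v - Real.pi / 2, Real.arctan v + Real.pi / 2, n) R γ) :
    ∃ ε : ℝ, (ε = 1 ∨ ε = -1) ∧ ∃ E s₀ : ℝ, 0 < E ∧
      ∀ s, γ s = stdRay a R v n e ε (E * (s - s₀)) := by
  obtain ⟨⟨⟨hsm, hgeo⟩, hnull⟩, hmemP, hpast, ⟨s₀, hs₀⟩, hmin⟩ := hγ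
  replace hmin : ∀ s, R ≤ (γ s).2.1 := fun s => hmin ⟨s, rfl⟩
  simp only at hs₀
  have hsm' : ContDiffOn ℝ ∞ (derivWithin γ Set.univ) Set.univ :=
    hsm.derivWithin uniqueDiffOn_univ (by simp)
  have D1 : ∀ s, HasDerivAt (fun s => (γ s).1) (derivWithin γ Set.univ s).1 s ∧
      HasDerivAt (fun s => (γ s).2.1) (derivWithin γ Set.univ s).2.1 s ∧
      HasDerivAt (fun s => (γ s).2.2) (derivWithin γ Set.univ s).2.2 s := fun s => by
    simpa only [hasDerivWithinAt_univ] using hasDerivWithinAt_components hsm (Set.mem_univ s)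
  set γ' := derivWithin γ Set.univ with hγ'
  have D2 : ∀ s, HasDerivAt (fun s => (γ' s).1) (derivWithin γ' Set.univ s).1 s ∧
      HasDerivAt (fun s => (γ' s).2.1) (derivWithin γ' Set.univ s).2.1 s ∧
      HasDerivAt (fun s => (γ' s).2.2) (derivWithin γ' Set.univ s).2.2 s := fun s => by
    simpa only [hasDerivWithinAt_univ] using hasDerivWithinAt_components hsm' (Set.mem_univ s)
  set γ'' := derivWithin γ' Set.univ with hγ''
  have EL : ∀ s, ∀ w : Coord d, inner ℝ (γ s).2.2 w.2.2 = (0 : ℝ) →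
      (γ'' s).1 * w.1 - (γ'' s).2.1 * w.2.1 -
        (2 * (γ s).2.1 * (γ' s).2.1 * inner ℝ (γ' s).2.2 w.2.2 +
          ((γ s).2.1 ^ 2 + a ^ 2) * inner ℝ (γ'' s).2.2 w.2.2) =
      -((γ s).2.1 * w.2.1 * inner ℝ (γ' s).2.2 (γ' s).2.2) := by
    intro s w hw
    have h1 := (hgeo s trivial).2 w hw
    rw [deriv_physMetric_base] at h1
    have h2 := derivWithin_physMetric_left (a := a) (fun s => (D1 s).1) (fun s => (D2 s).1)
      (fun s => (D1 s).2.1) (fun s => (D2 s).2.1) (fun s => (D1 s).2.2) (fun s => (D2 s).2.2) s w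
    rw [← h2]
    refine h1.trans ?_
    ring
  set E := (γ' s₀).1 with hE
  have hE0 : 0 < E := (hnull s₀ trivial).1
  -- Variation along t: the energy is conserved. Variations along r and along the tangent of the
  -- circle give the other two equations below.
  have ht'' : ∀ s, (γ'' s).1 = 0 := fun s => by simpa using EL s (1, 0, 0) (by simp)
  have ht' : ∀ s, (γ' s).1 = E := fun s =>
    eq_const_of_hasDerivAt_zero (fun s => ht'' s ▸ (D2 s).1) s s₀
  have ht : ∀ s, (γ s).1 = (γ s₀).1 + E * (s - s₀) := by
    intro s
    have h1 : ∀ s, HasDerivAt (fun s => (γ s).1 - E * (s - s₀)) 0 s := fun s =>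
      ((D1 s).1.sub (((hasDerivAt_id s).sub_const s₀).const_mul E)).congr_deriv (by simp [ht' s])
    have := eq_const_of_hasDerivAt_zero h1 s s₀
    simp only [sub_self, mul_zero, sub_zero] at this
    linarith
  have inn : ∀ (m : EuclideanSpace ℝ (Fin d)) {c : ℝ → EuclideanSpace ℝ (Fin d)} {c'} {s : ℝ},
      HasDerivAt c c' s → HasDerivAt (fun s => (inner ℝ m (c s) : ℝ)) (inner ℝ m c') s := by
    intro m c c' s h
    refine ((hasDerivAt_const s m).inner ℝ h).congr_deriv ?_
    simp
  have hen : (inner ℝ e n : ℝ) = 0 := by rw [real_inner_comm]; exact hne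
  have hnn : (inner ℝ n n : ℝ) = 1 := by rw [real_inner_self_eq_norm_sq, hn, one_pow]
  have hee : (inner ℝ e e : ℝ) = 1 := by rw [real_inner_self_eq_norm_sq, he, one_pow]
  have dec : ∀ s, (γ s).2.2 = (inner ℝ n (γ s).2.2 : ℝ) • n + (inner ℝ e (γ s).2.2 : ℝ) • e :=
    fun s => eq_inner_add_inner hP hn he hne hnP heP (hmemP s)
  have dec' : ∀ s, (γ' s).2.2 = (inner ℝ n (γ' s).2.2 : ℝ) • n +
      (inner ℝ e (γ' s).2.2 : ℝ) • e := by
    intro s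
    have h1 := ((inn n (D1 s).2.2).smul_const n).add ((inn e (D1 s).2.2).smul_const e)
    exact (D1 s).2.2.unique (h1.congr_of_eventuallyEq (Filter.Eventually.of_forall dec))
  set x : ℝ → ℝ := fun s => inner ℝ n (γ s).2.2 with hx
  set y : ℝ → ℝ := fun s => inner ℝ e (γ s).2.2 with hy
  set x' : ℝ → ℝ := fun s => inner ℝ n (γ' s).2.2 with hx'
  set y' : ℝ → ℝ := fun s => inner ℝ e (γ' s).2.2 with hy'
  have nsq : ∀ z w : ℝ, (inner ℝ (z • n + w • e) (z • n + w • e) : ℝ) = z ^ 2 + w ^ 2 := by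
    intro z w
    simp only [inner_add_left, inner_add_right, inner_smul_left, inner_smul_right, hne, hen, hnn,
      hee, conj_trivial]
    ring
  have hc : ∀ s, x s ^ 2 + y s ^ 2 = 1 := by
    intro s
    rw [← nsq, ← dec s, real_inner_self_eq_norm_sq, (hgeo s trivial).1, one_pow]
  have hspd : ∀ s, (inner ℝ (γ' s).2.2 (γ' s).2.2 : ℝ) = x' s ^ 2 + y' s ^ 2 := by
    intro s
    rw [← nsq, ← dec' s]
  obtain ⟨ε, hε, φ, hsol⟩ := ray_classification (a := a) hR hE0
    (fun s => (D1 s).2.1) (fun s => (D2 s).2.1) (fun s => inn n (D1 s).2.2)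
    (fun s => inn n (D2 s).2.2) (fun s => inn e (D1 s).2.2) (fun s => inn e (D2 s).2.2)
    hs₀ hmin hc
    (fun s => by
      have := EL s (0, 1, 0) (by simp)
      simp only [inner_zero_right] at this
      rw [hspd] at this
      linarith)
    (fun s => by
      have := (hnull s trivial).2
      simp only [physMetric] at this
      rw [hspd, ht'] at this
      linarith)
    (fun s => by
      have := EL s (0, 0, (-y s) • n + x s • e) (by
        simp only [inner_add_right, inner_smul_right, real_inner_comm n, real_inner_comm e]
        change -y s * x s + x s * y s = 0
        ring)
      simp only [inner_add_right, inner_smul_right, real_inner_comm n, real_inner_comm e] at this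
      change _ - _ - (_ * (-y s * x' s + x s * y' s) + _ * (-y s * _ + x s * _)) = _ at this
      linarith)
  have c1 := (continuous_fst.tendsto _).comp hpast
  have c2 := ((continuous_fst.comp continuous_snd).tendsto _).comp hpast
  have c3 : Tendsto (fun s => (γ s).2.2) atBot (𝓝 n) :=
    ((continuous_snd.comp continuous_snd).tendsto _).comp hpast
  have haff : Tendsto (fun s => E * (s - s₀)) atBot atBot :=
    (tendsto_atBot_add_const_right _ (-s₀) tendsto_id).const_mul_atBot hE0
  have hv : Tendsto (fun s => (γ s).1 + (γ s).2.1) atBot (𝓝 v) := by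
    have h1 := (c1.add c2).div_const 2
    have h2 : (Real.arctan v - Real.pi / 2 + (Real.arctan v + Real.pi / 2)) / 2 =
        Real.arctan v := by ring
    change Tendsto _ _ (𝓝 ((Real.arctan v - Real.pi / 2 + (Real.arctan v + Real.pi / 2)) / 2))
      at h1
    rw [h2] at h1
    have h3 := (Real.continuousAt_tan.2 (Real.cos_arctan_pos v).ne').tendsto.comp h1
    rw [Real.tan_arctan] at h3
    refine h3.congr fun s => ?_
    simp only [Function.comp, compactify]
    rw [← Real.tan_arctan ((γ s).1 + (γ s).2.1)]
    congr 1
    rw [Real.tan_arctan]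
    ring
  -- The limit of t + r at past infinity is v by the endpoint and t(s₀) - D by the explicit
  -- solution.
  have ht0 : (γ s₀).1 = v + rayDelay a R := by
    have h1 := ((tendsto_add_radius_atBot (a := a) hR).comp haff).const_add (γ s₀).1
    have h2 := tendsto_nhds_unique hv (h1.congr fun s => by
      simp only [Function.comp]
      rw [ht s, (hsol s).1]; ring)
    linarith
  have hang := (tendsto_rayAngle_atBot (a := a) hR).comp ((tendsto_rapidity_atBot (a := a) hR).comp haff)
  have hδ : Tendsto (fun s => ε * rayAngle a R (rapidity a R (E * (s - s₀))) + φ) atBot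
      (𝓝 (ε * -halfAngle a R + φ)) := (hang.const_mul ε).add_const φ
  -- The past direction n determines the phase only modulo 2π, hence only its cosine and sine; that
  -- is all the solution depends on.
  have hcos : Real.cos (ε * -halfAngle a R + φ) = 1 := by
    have h1 : Tendsto x atBot (𝓝 (inner ℝ n n)) := tendsto_const_nhds.inner c3
    rw [hnn] at h1
    exact tendsto_nhds_unique ((Real.continuous_cos.tendsto _).comp hδ)
      (h1.congr fun s => (hsol s).2.1)
  have hsin : Real.sin (ε * -halfAngle a R + φ) = 0 := by
    have h1 : Tendsto y atBot (𝓝 (inner ℝ e n)) := tendsto_const_nhds.inner c3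
    rw [hen] at h1
    exact tendsto_nhds_unique ((Real.continuous_sin.tendsto _).comp hδ)
      (h1.congr fun s => (hsol s).2.2)
  refine ⟨ε, hε, E, s₀, hE0, fun s => ?_⟩
  have hs : ε * rayAngle a R (rapidity a R (E * (s - s₀))) + φ =
      ε * (rayAngle a R (rapidity a R (E * (s - s₀))) + halfAngle a R) +
        (ε * -halfAngle a R + φ) := by ring
  obtain ⟨k1, k2, k3⟩ := hsol s
  rw [hs, Real.cos_add, hcos, hsin, mul_one, mul_zero, sub_zero] at k2
  rw [hs, Real.sin_add, hcos, hsin, mul_one, mul_zero, add_zero] at k3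
  refine Prod.ext ?_ (Prod.ext k1 ?_)
  · simp only [stdRay]; rw [ht s, ht0]
  · simp only [stdRay]
    rw [← k2, ← k3]
    exact dec s

theorem reflectAngle_stdRay (hn : ‖n‖ = 1) (hne : inner ℝ n e = 0) (σ : ℝ) :
    reflectAngle n (stdRay a R v n e ε σ) = stdRay a R v n e (-ε) σ := by
  simp only [reflectAngle, stdRay]
  rw [Submodule.reflection_singleton_apply, inner_add_right, inner_smul_right, inner_smul_right,
    hne, real_inner_self_eq_norm_sq, hn, neg_mul, Real.cos_neg, Real.sin_neg]
  refine Prod.ext rfl (Prod.ext rfl ?_)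
  simp only [RCLike.ofReal_real_eq_id, id]
  module

theorem range_stdRay_comp {E s₀ : ℝ} (hE : 0 < E) {γ : ℝ → Coord d}
    (h : ∀ s, γ s = stdRay a R v n e ε (E * (s - s₀))) :
    Set.range γ = Set.range (stdRay a R v n e ε) := by
  ext x
  constructor
  · rintro ⟨s, rfl⟩
    exact ⟨_, (h s).symm⟩
  · rintro ⟨σ, rfl⟩
    refine ⟨σ / E + s₀, ?_⟩
    rw [h]
    congr 1
    field_simp
    ring

theorem hasFutureEndpoint_of_eq_stdRay (hR : 0 < R) {E s₀ : ℝ} (hE : 0 < E) {γ : ℝ → Coord d}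
    (h : ∀ s, γ s = stdRay a R v n e ε (E * (s - s₀))) :
    HasFutureEndpoint γ (rayEnd v n e ε (rayDelay a R) (halfAngle a R)) := by
  have haff : Tendsto (fun s => E * (s - s₀)) atTop atTop :=
    (tendsto_atTop_add_const_right _ (-s₀) tendsto_id).const_mul_atTop hE
  exact ((tendsto_stdRay_atTop hR).comp haff).congr fun s => by simp [h s]

theorem rayEnd_mem_scriPlus₁ (hn : ‖n‖ = 1) (he : ‖e‖ = 1) (hne : inner ℝ n e = 0) (D A : ℝ) :
    rayEnd v n e ε D A ∈ scriPlus₁ d := by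
  have h1 := Real.neg_pi_div_two_lt_arctan (v + 2 * D)
  have h2 := Real.arctan_lt_pi_div_two (v + 2 * D)
  refine ⟨?_, ?_, ?_, norm_cos_add_sin hn he hne _⟩ <;> simp only [rayEnd] <;> linarith

/-- Far rays become straight lines: no delay and a half turn, which ends at -n for either sense of
rotation. -/
theorem tendsto_rayEnd (a v : ℝ) (n e : EuclideanSpace ℝ (Fin d)) (hε : ε = 1 ∨ ε = -1) :
    Tendsto (fun R => rayEnd v n e ε (rayDelay a R) (halfAngle a R)) atTop
      (𝓝 (Real.pi / 2 + Real.arctan v, Real.pi / 2 - Real.arctan v, -n)) := by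
  have hc : Continuous fun x : ℝ × ℝ => rayEnd v n e ε x.1 x.2 := by
    unfold rayEnd
    have := Real.continuous_arctan
    fun_prop
  have h1 := (hc.tendsto (0, Real.pi / 2)).comp
    ((tendsto_rayDelay a).prodMk_nhds (tendsto_halfAngle a))
  have h2 : rayEnd v n e ε 0 (Real.pi / 2) =
      (Real.pi / 2 + Real.arctan v, Real.pi / 2 - Real.arctan v, -n) := by
    have e1 : 2 * (Real.pi / 2) = Real.pi := by ring
    rcases hε with rfl | rfl <;> simp [rayEnd, e1]
  change Tendsto _ _ (𝓝 (rayEnd v n e ε 0 (Real.pi / 2))) at h1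
  rw [h2] at h1
  exact h1

end

end Wormhole

/-! ### Proof of the proposition -/

theorem proposition3p1 (d : ℕ) (hd : 3 ≤ d) (a : ℝ) (ha : 0 < a)
    (p : Wormhole.Coord d) (hp : p ∈ Wormhole.scriMinus₁ d) :
    ∃ q ∈ Wormhole.scriPlus₁ d,
      -- the equatorial null geodesics from `p`, in any equatorial plane through `p`
      (∀ P : Submodule ℝ (EuclideanSpace ℝ (Fin d)), Module.finrank ℝ P = 2 → p.2.2 ∈ P →
        -- for every `R > 0` there is one with impact parameter `R`, and only one up to `φ ↦ -φ`
        (∀ R : ℝ, 0 < R →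
          (∃ γ, Wormhole.IsEquatorialRay a P p R γ) ∧
          (∀ γ γ', Wormhole.IsEquatorialRay a P p R γ → Wormhole.IsEquatorialRay a P p R γ' →
            Set.range γ' = Set.range γ ∨
              Set.range γ' = Wormhole.reflectAngle p.2.2 '' Set.range γ) ∧
          (∀ γ, Wormhole.IsEquatorialRay a P p R γ →
            ∃ x ∈ Wormhole.scriPlus₁ d, Wormhole.HasFutureEndpoint γ x)) ∧
        -- their future endpoints tend to `q` as `R → ∞`
        (∀ U ∈ nhds q, ∃ R₀ : ℝ, ∀ R : ℝ, R₀ < R → ∀ γ x,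
          Wormhole.IsEquatorialRay a P p R γ → Wormhole.HasFutureEndpoint γ x → x ∈ U)) ∧
      -- the points that cannot be timelike connected to `p` lie on past null geodesics from `q`
      (∀ x ∈ Wormhole.scriPlus₁ d, x ∉ Wormhole.timelikeFuture a p ↔
        (x = q ∨ Wormhole.NullGeodesicConnected a x q)) ∧
      Wormhole.timelikeFuture a p ∩ Wormhole.scriPlus₁ d =
        Wormhole.scriPlus₁ d \ (Wormhole.causalPast a q ∩ Wormhole.scriPlus₁ d) := by
  obtain ⟨T, χ, n⟩ := p
  obtain ⟨h1, h2, h3, hn⟩ := id hp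
  simp only at h1 h2 h3 hn
  set v := Real.tan (χ - Real.pi / 2) with hv
  have av : Real.arctan v = χ - Real.pi / 2 := Real.arctan_tan (by linarith) (by linarith)
  have ep : ((T, χ, n) : Wormhole.Coord d) =
      (Real.arctan v - Real.pi / 2, Real.arctan v + Real.pi / 2, n) := by
    rw [av]; refine Prod.ext ?_ (Prod.ext ?_ rfl) <;> simp only <;> linarith
  -- The point q: the antipodal direction, with retarded time equal to the advanced time v of `p`.
  have eq : ((χ, Real.pi - χ, -n) : Wormhole.Coord d) =
      (Real.pi / 2 + Real.arctan v, Real.pi / 2 - Real.arctan v, -n) := by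
    rw [av]; refine Prod.ext ?_ (Prod.ext ?_ rfl) <;> simp only <;> ring
  have hq : ((χ, Real.pi - χ, -n) : Wormhole.Coord d) ∈ Wormhole.scriPlus₁ d := by
    refine ⟨h2, ?_, ?_, ?_⟩ <;> simp only [norm_neg]
    exacts [by linarith, by ring, hn]
  have reach : ∀ x ∈ Wormhole.scriPlus₁ d, x ∈ Wormhole.timelikeFuture a (T, χ, n) ↔
      (x.2.2 ≠ -n ∨ χ < x.1) := by
    intro x hx
    refine ⟨fun h => ?_, Wormhole.mem_timelikeFuture (by omega) a hp hx⟩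
    by_contra! hcon
    exact Wormhole.not_mem_timelikeFuture hp hx hcon.1 hcon.2 h
  have past : ∀ x ∈ Wormhole.scriPlus₁ d, (x = (χ, Real.pi - χ, -n) ∨
      Wormhole.NullGeodesicConnected a x (χ, Real.pi - χ, -n)) ↔ (x.2.2 = -n ∧ x.1 ≤ χ) := by
    intro x hx
    constructor
    · rintro (rfl | h)
      · exact ⟨rfl, le_rfl⟩
      · obtain ⟨γ, hγ⟩ := Wormhole.isCausalCurve_of_nullGeodesicConnected h
        exact (Wormhole.eq_and_lt_of_isCausalCurve hγ hx).imp_right le_of_lt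
    · rintro ⟨hax, hle⟩
      rcases lt_or_eq_of_le hle with hlt | heq
      · exact Or.inr (Wormhole.nullGeodesicConnected_generator hx hq hax hlt)
      · refine Or.inl (Prod.ext heq (Prod.ext ?_ hax))
        have := hx.2.2.1
        simp only
        linarith
  have past' : ∀ x ∈ Wormhole.scriPlus₁ d,
      x ∈ Wormhole.causalPast a (χ, Real.pi - χ, -n) ↔ (x.2.2 = -n ∧ x.1 ≤ χ) := by
    intro x hx
    rw [← past x hx]
    constructor
    · rintro (h | ⟨γ, hγ⟩)
      · exact Or.inl h
      · exact (past x hx).2 ((Wormhole.eq_and_lt_of_isCausalCurve hγ hx).imp_right le_of_lt)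
    · exact Or.imp_right Wormhole.isCausalCurve_of_nullGeodesicConnected
  refine ⟨(χ, Real.pi - χ, -n), hq, ?_, ?_, ?_⟩
  · intro P hP hnP
    obtain ⟨e, heP, he, hne⟩ := Wormhole.exists_unit_orthogonal P hP.ge hn hnP
    rw [ep, eq]
    refine ⟨fun R hR => ⟨⟨_, Wormhole.isEquatorialRay_stdRay hR hn he hne hnP heP (one_pow 2)⟩,
      ?_, ?_⟩, ?_⟩
    · intro γ γ' hγ hγ'
      obtain ⟨ε, hε, E, s₀, hE, h⟩ := Wormhole.exists_eq_stdRay hP hR hn he hne hnP heP hγ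
      obtain ⟨ε', hε', E', s₀', hE', h'⟩ := Wormhole.exists_eq_stdRay hP hR hn he hne hnP heP hγ'
      rw [Wormhole.range_stdRay_comp hE h, Wormhole.range_stdRay_comp hE' h', ← Set.range_comp]
      -- Energy and parameter origin do not affect the image, so two rays differ at most in the
      -- sense of rotation, which the reflection reverses.
      have hcases : ε' = ε ∨ ε' = -ε := by
        rcases hε with rfl | rfl <;> rcases hε' with rfl | rfl <;> norm_num
      rcases hcases with rfl | rfl
      · exact Or.inl rfl
      · exact Or.inr (congrArg Set.range
          (funext fun σ => (Wormhole.reflectAngle_stdRay hn hne σ).symm))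
    · intro γ hγ
      obtain ⟨ε, -, E, s₀, hE, h⟩ := Wormhole.exists_eq_stdRay hP hR hn he hne hnP heP hγ
      exact ⟨_, Wormhole.rayEnd_mem_scriPlus₁ hn he hne _ _,
        Wormhole.hasFutureEndpoint_of_eq_stdRay hR hE h⟩
    · intro U hU
      -- One bound on R for both senses of rotation.
      obtain ⟨R₁, hR₁⟩ := Filter.eventually_atTop.1
        (((Wormhole.tendsto_rayEnd a v n e (Or.inl rfl)).eventually_mem hU).and
          ((Wormhole.tendsto_rayEnd a v n e (Or.inr rfl)).eventually_mem hU))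
      refine ⟨max R₁ 0, fun R hR γ x hγ hx => ?_⟩
      have hR0 : 0 < R := (le_max_right _ _).trans_lt hR
      obtain ⟨ε, hε, E, s₀, hE, h⟩ := Wormhole.exists_eq_stdRay hP hR0 hn he hne hnP heP hγ
      rw [tendsto_nhds_unique hx (Wormhole.hasFutureEndpoint_of_eq_stdRay hR0 hE h)]
      have := hR₁ R ((le_max_left _ _).trans hR.le)
      rcases hε with rfl | rfl
      exacts [this.1, this.2]
  · intro x hx
    rw [reach x hx, past x hx, not_or, not_not, not_lt]
  · ext x
    constructor
    · rintro ⟨h, hx⟩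
      refine ⟨hx, fun hp => ?_⟩
      have k1 := (reach x hx).1 h
      have k2 := (past' x hx).1 hp.1
      exact k1.elim (fun h => h k2.1) fun h => absurd k2.2 (not_le.2 h)
    · rintro ⟨hx, hn⟩
      refine ⟨(reach x hx).2 ?_, hx⟩
      by_contra! hcon
      exact hn ⟨(past' x hx).2 hcon, hx⟩
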